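/- **Conventions.** For a skew shape $\lambda/\mu$ and $n\ge\ell(\lambda)$ let $\mathrm{JT}^n_{\lambda/\mu}(x)=\big(e_{\lambda_i-\mu_j-i+j}(x)\big)_{i,j=1}^n$, where $e_d(x)$ is the elementary symmetric function in the variables $x=(x_1,x_2,\dots)$, with $e_0=1$ and $e_d=0$ for $d<0$. Let $*$ be the entrywise product of matrices. The skew Schur function is $s_{\lambda/\mu}(x)=\det\big(e_{\lambda'_i-\mu'_j-i+j}(x)\big)_{i,j=1}^{\ell(\lambda')}$, and $(\lambda/\mu)'=\lambda'/\mu'$. A ribbon is a connected skew shape without a $2\times2$ block of cells; $\mathcal R_m$ is the set of ribbons $\lambda/\mu$ with $m$ cells and $\{i:\lambda_i>\mu_i\}=\{1,\dots,\ell(\lambda)\}$. Label the cells of a ribbon $R$ by $1,\dots,m$ along the ribbon, starting from the top-right cell; $\mathrm{Des}(R)$ is the set of $i$ such that cell $i$ is immediately above cell $i+1$. For a set $J$ of positive integers put $d(J,R)=\{\sum_{j=1}^i(\lambda_j-\mu_j): i\in J\}$. The Temperley–Lieb algebra $\mathrm{TL}_n(2)$ is the $\mathbb C$-algebra generated by $t_1,\dots,t_{n-1}$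 with relations $t_i^2=2t_i$, $t_it_jt_i=t_i$ if $|i-j|=1$, and $t_it_j=t_jt_i$ if $|i-j|\ge2$; its standard basis $\mathcal B_n$ is the set of Kauffman diagrams, multiplied by concatenation with a factor $2$ for each loop. Let $\theta:\mathbb C[\mathfrak S_n]\to\mathrm{TL}_n(2)$ be the algebra homomorphism with $\theta(s_i)=t_i-1$, where $s_i=(i,i+1)$ and permutations are composed from left to right. For $\tau\in\mathcal B_n$ put $\mathrm{imm}_\tau(M)=\sum_{w\in\mathfrak S_n}f_\tau(w)\,M_{1,w(1)}\cdots M_{n,w(n)}$, where $f_\tau(w)$ is the coefficient of $\tau$ in $\theta(w)$. For $I\subseteq\{1,\dots,n-1\}$ let $\tau(I)=\prod_{i\in I}t_i\in\mathcal B_n$, the product being taken in increasing order from left to right. **Theorem.** Let $k\ge1$, let $R=\lambda/\mu\in\mathcal R_m$, put $\ell=\ell(\lambda)$, and let $n\ge\ell$. 1. Let $I\subseteq\{1,\dots,\ell-1\}$. There is a ribbon $R_I\in\mathcal R_m$ with $\mathrm{Des}(R_I)=d(\{1,\dots,\ell-1\}\setminus I,\,R)$, and for every such $R_I=\rho/\pi$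 and every $N\ge\ell(\rho)$ $$\mathrm{imm}_{\tau(I)}\big(\mathrm{JT}^n_R(x^{(1)})*\cdots*\mathrm{JT}^n_R(x^{(k)})\big)=\det\big(\mathrm{JT}^N_{R_I}(x^{(1)})*\cdots*\mathrm{JT}^N_{R_I}(x^{(k)})\big).$$ In particular (the case $k=1$), $\mathrm{imm}_{\tau(I)}(\mathrm{JT}^n_R(x))=s_{(R_I)'}(x)$. 2. If $\tau\in\mathcal B_n$ is not of the form $\tau(I)$ with $I\subseteq\{1,\dots,\ell-1\}$, then $\mathrm{imm}_\tau(\mathrm{JT}^n_R(x))=0$. Hence every nonzero Temperley–Lieb immanant of a ribbon Jacobi–Trudi matrix $\mathrm{JT}^n_R(x)$ is a single ribbon Schur function. -/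

import Mathlib

namespace TLImm

section SymmetricGroup

/-! The symmetric group is presented by its simple transpositions: any family of elements of a
monoid satisfying the Coxeter relations extends to a homomorphism on permutations. This is used
only to construct the homomorphism `theta` below. -/

/-- The product `g k * g (k + 1) * ⋯ * g (n - 1)` (which is `1` for `n ≤ k`). -/
def descProd {M : Type*} [Monoid M] (g : ℕ → M) (k : ℕ) : ℕ → M
  | 0 => 1
  | n + 1 => if k ≤ n then descProd g k n * g n else 1

variable {M : Type*} [Monoid M]

theorem descProd_self (g : ℕ → M) (n : ℕ) : descProd g n n = 1 := by
  cases n <;> simp [descProd]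

theorem descProd_succ (g : ℕ → M) {k n : ℕ} (h : k ≤ n) :
    descProd g k (n + 1) = descProd g k n * g n := by simp [descProd, h]

theorem descProd_left (g : ℕ → M) {k n : ℕ} (h : k < n) :
    descProd g k n = g k * descProd g (k + 1) n := by
  induction n, h using Nat.le_induction with
  | base => simp [descProd_succ, descProd_self]
  | succ n hn ih => rw [descProd_succ g (by omega), ih, descProd_succ g hn, mul_assoc]

/-- The Coxeter relations of type A for `g 0, …, g (N - 1)`. -/
structure IsCox (g : ℕ → M) (N : ℕ) : Prop where
  sq : ∀ i, i < N → g i * g i = 1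
  braid : ∀ i, i + 1 < N → g i * g (i + 1) * g i = g (i + 1) * g i * g (i + 1)
  comm : ∀ i j, i + 2 ≤ j → j < N → g i * g j = g j * g i

theorem IsCox.comm_descProd {g : ℕ → M} {N : ℕ} (hg : IsCox g N) {i k n : ℕ} (hk : i + 2 ≤ k)
    (hn : n ≤ N) : g i * descProd g k n = descProd g k n * g i := by
  induction n with
  | zero => simp [descProd]
  | succ n ih =>
    by_cases h : k ≤ n
    · rw [descProd_succ g h, ← mul_assoc, ih (by omega), mul_assoc, hg.comm i n (by omega) (by omega),
        mul_assoc]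
    · simp [descProd, h]

theorem IsCox.shift_descProd {g : ℕ → M} {N : ℕ} (hg : IsCox g N) {i k n : ℕ} (hk : k ≤ i)
    (hin : i + 1 < n) (hn : n ≤ N) :
    g (i + 1) * descProd g k n = descProd g k n * g i := by
  induction n, hin using Nat.le_induction with
  | base =>
    rw [descProd_succ g (by omega), descProd_succ g hk]
    have : g (i + 1) * descProd g k i = descProd g k i * g (i + 1) := by
      have : ∀ j, j ≤ i → g (i + 1) * descProd g k j = descProd g k j * g (i + 1) := by
        intro j hj
        induction j with
        | zero => simp [descProd]
        | succ j ih =>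
          by_cases h : k ≤ j
          · rw [descProd_succ g h, ← mul_assoc, ih (by omega), mul_assoc,
              ← hg.comm j (i + 1) (by omega) (by omega), mul_assoc]
          · simp [descProd, h]
      exact this i le_rfl
    calc _ = (g (i + 1) * descProd g k i) * g i * g (i + 1) := by simp [mul_assoc]
      _ = descProd g k i * (g (i + 1) * g i * g (i + 1)) := by rw [this]; simp [mul_assoc]
      _ = _ := by rw [← hg.braid i (by omega)]; simp [mul_assoc]
  | succ n hn' ih =>
    rw [descProd_succ g (by omega), ← mul_assoc, ih (by omega), mul_assoc,
      hg.comm i n (by omega) (by omega), mul_assoc]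

/-- The submonoid generated by the first `n` generators -/
def genSub (g : ℕ → M) (n : ℕ) : Submonoid M := Submonoid.closure {x | ∃ i < n, x = g i}

theorem gen_mem (g : ℕ → M) {i n : ℕ} (h : i < n) : g i ∈ genSub g n :=
  Submonoid.subset_closure ⟨i, h, rfl⟩

theorem IsCox.normal_form {g : ℕ → M} {N : ℕ} (hg : IsCox g N) {n : ℕ} (hn : n + 1 ≤ N) {x : M}
    (hx : x ∈ genSub g (n + 1)) :
    ∃ k ≤ n + 1, ∃ y ∈ genSub g n, x = descProd g k (n + 1) * y := by
  refine Submonoid.closure_induction_left (s := {x | ∃ i < n + 1, x = g i})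
    (motive := fun x _ => ∃ k ≤ n + 1, ∃ y ∈ genSub g n, x = descProd g k (n + 1) * y)
    ⟨n + 1, le_rfl, 1, one_mem _, by simp [descProd_self]⟩ ?_ hx
  rintro _ ⟨i, hi, rfl⟩ _ _ ⟨k, hk, y, hy, rfl⟩
  rcases lt_trichotomy i k with h | rfl | h
  · rcases Nat.lt_or_ge (i + 1) k with h' | h'
    · refine ⟨k, hk, g i * y, mul_mem (gen_mem g (by omega)) hy, ?_⟩
      rw [← mul_assoc, hg.comm_descProd h' hn, mul_assoc]
    · obtain rfl : k = i + 1 := by omega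
      refine ⟨i, by omega, y, hy, ?_⟩
      rw [descProd_left g hi, mul_assoc]
  · refine ⟨i + 1, by omega, y, hy, ?_⟩
    rw [descProd_left g hi, ← mul_assoc, ← mul_assoc, hg.sq i (by omega), one_mul]
  · obtain ⟨i, rfl⟩ : ∃ j, i = j + 1 := ⟨i - 1, by omega⟩
    refine ⟨k, hk, g i * y, mul_mem (gen_mem g (by omega)) hy, ?_⟩
    rw [← mul_assoc, hg.shift_descProd (by omega) (by omega) hn, mul_assoc]

/-- The simple transposition `(i, i + 1)` of `ℕ`. -/
def natS (i : ℕ) : Equiv.Perm ℕ := Equiv.swap i (i + 1)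

theorem natS_cox (N : ℕ) : IsCox natS N where
  sq i _ := Equiv.swap_mul_self _ _
  braid i _ := by ext x; simp only [natS, Equiv.Perm.mul_apply, Equiv.swap_apply_def]; grind
  comm i j h _ := by ext x; simp only [natS, Equiv.Perm.mul_apply, Equiv.swap_apply_def]; grind

theorem descProd_natS {k n : ℕ} (h : k ≤ n) : descProd natS k n n = k := by
  induction h using Nat.decreasingInduction with
  | self => simp [descProd_self]
  | of_succ k h ih =>
    rw [descProd_left _ h, Equiv.Perm.mul_apply, ih]; simp [natS]

theorem eq_one_of_fst {A : Type*} [Monoid A] {T : ℕ → A} {N : ℕ} (hT : IsCox T N) {n : ℕ}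
    (hn : n ≤ N) (x : Equiv.Perm ℕ × A) (hx : x ∈ genSub (fun i => (natS i, T i)) n)
    (h1 : x.1 = 1) : x.2 = 1 := by
  have hg : IsCox (fun i => (natS i, T i)) N :=
    { sq := fun i hi => Prod.ext ((natS_cox N).sq i hi) (hT.sq i hi)
      braid := fun i hi => Prod.ext ((natS_cox N).braid i hi) (hT.braid i hi)
      comm := fun i j h hi => Prod.ext ((natS_cox N).comm i j h hi) (hT.comm i j h hi) }
  induction n generalizing x with
  | zero => simp [genSub] at hx; simp [hx]
  | succ n ih =>
    obtain ⟨k, hk, y, hy, rfl⟩ := hg.normal_form hn hx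
    have hfst : ∀ k m, (descProd (fun i => (natS i, T i)) k m).1 = descProd natS k m := by
      intro k m
      induction m with
      | zero => rfl
      | succ m ih => simp only [descProd]; split_ifs <;> simp [ih]
    have hfix : y.1 (n + 1) = n + 1 := by
      refine Submonoid.closure_induction (s := {x | ∃ i < n, x = (natS i, T i)})
        (motive := fun y _ => y.1 (n + 1) = n + 1) ?_ rfl ?_ hy
      · rintro _ ⟨i, hi, rfl⟩
        exact Equiv.swap_apply_of_ne_of_ne (by omega) (by omega)
      · intro a b _ _ ha hb
        simp [hb, ha]
    have hk' : k = n + 1 := by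
      have := congrArg (fun e : Equiv.Perm ℕ => e (n + 1)) h1
      simpa [hfst, hfix, descProd_natS hk] using this
    subst hk'
    rw [descProd_self, one_mul] at h1 ⊢
    exact ih (by omega) y hy h1

theorem IsCox.exists_inv {g : ℕ → M} {N : ℕ} (hg : IsCox g N) {x : M} (hx : x ∈ genSub g N) :
    ∃ y ∈ genSub g N, y * x = 1 ∧ x * y = 1 := by
  refine Submonoid.closure_induction (s := {x | ∃ i < N, x = g i})
    (motive := fun x _ => ∃ y ∈ genSub g N, y * x = 1 ∧ x * y = 1) ?_ ?_ ?_ hx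
  · rintro _ ⟨i, hi, rfl⟩
    exact ⟨g i, gen_mem g hi, hg.sq i hi, hg.sq i hi⟩
  · exact ⟨1, one_mem _, by simp⟩
  · rintro a b _ _ ⟨a', ha, h1, h2⟩ ⟨b', hb, h3, h4⟩
    refine ⟨b' * a', mul_mem hb ha, ?_, ?_⟩
    · rw [mul_assoc, ← mul_assoc a', h1, one_mul, h3]
    · rw [mul_assoc, ← mul_assoc b, h4, one_mul, h2]

theorem IsCox.pair {A : Type*} [Monoid A] {T : ℕ → A} {N : ℕ} (hT : IsCox T N) :
    IsCox (fun i => (natS i, T i)) N where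
  sq := fun i hi => Prod.ext ((natS_cox N).sq i hi) (hT.sq i hi)
  braid := fun i hi => Prod.ext ((natS_cox N).braid i hi) (hT.braid i hi)
  comm := fun i j h hi => Prod.ext ((natS_cox N).comm i j h hi) (hT.comm i j h hi)

theorem eq_snd_of_fst {A : Type*} [Monoid A] {T : ℕ → A} {N : ℕ} (hT : IsCox T N)
    {x y : Equiv.Perm ℕ × A} (hx : x ∈ genSub (fun i => (natS i, T i)) N)
    (hy : y ∈ genSub (fun i => (natS i, T i)) N) (h : x.1 = y.1) : x.2 = y.2 := by
  obtain ⟨z, hz, h1, h2⟩ := hT.pair.exists_inv hx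
  have h3 : (z * y).2 = 1 := eq_one_of_fst hT le_rfl _ (mul_mem hz hy)
    (by rw [Prod.fst_mul, ← h, ← Prod.fst_mul, h1]; rfl)
  calc x.2 = x.2 * (z * y).2 := by rw [h3, mul_one]
    _ = ((x * z) * y).2 := by simp [mul_assoc]
    _ = y.2 := by rw [h2, one_mul]

theorem exists_permHom {A : Type*} [Monoid A] (n : ℕ) (T : ℕ → A) (hT : IsCox T n) :
    ∃ φ : Equiv.Perm (Fin (n + 1)) →* A,
      ∀ i : Fin n, φ (Equiv.swap i.castSucc i.succ) = T i := by
  obtain ⟨ι, hι⟩ : ∃ ι : Equiv.Perm (Fin (n + 1)) →* Equiv.Perm ℕ,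
      ∀ i : Fin n, ι (Equiv.swap i.castSucc i.succ) = natS i := by
    let ι : Equiv.Perm (Fin (n + 1)) →* Equiv.Perm ℕ :=
      Equiv.Perm.viaEmbeddingHom (Fin.valEmbedding : Fin (n + 1) ↪ ℕ)
    refine ⟨ι, fun i => ?_⟩
    ext x
    by_cases hx : x < n + 1
    · have := Equiv.Perm.viaEmbedding_apply (Equiv.swap i.castSucc i.succ)
        (Fin.valEmbedding : Fin (n + 1) ↪ ℕ) ⟨x, hx⟩
      simp only [Fin.valEmbedding_apply] at this
      simp only [ι, Equiv.Perm.viaEmbeddingHom_apply, this, natS, Equiv.swap_apply_def, Fin.ext_iff,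
        Fin.val_castSucc, Fin.val_succ]
      split_ifs <;> simp
    · have := Equiv.Perm.viaEmbedding_apply_of_notMem (Equiv.swap i.castSucc i.succ)
        (Fin.valEmbedding : Fin (n + 1) ↪ ℕ) x (by rintro ⟨y, rfl⟩; exact hx y.2)
      simp only [ι, Equiv.Perm.viaEmbeddingHom_apply, this, natS]
      rw [Equiv.swap_apply_of_ne_of_ne] <;> omega
  have hex : ∀ w, ∃ a, (ι w, a) ∈ genSub (fun i => (natS i, T i)) n := by
    intro w
    have hw : w ∈ Submonoid.closure
        (Set.range fun i : Fin n => Equiv.swap i.castSucc i.succ) := by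
      rw [Equiv.Perm.mclosure_swap_castSucc_succ]; trivial
    refine Submonoid.closure_induction (motive := fun w _ =>
      ∃ a, (ι w, a) ∈ genSub (fun i => (natS i, T i)) n) ?_ ?_ ?_ hw
    · rintro _ ⟨i, rfl⟩
      exact ⟨T i, by rw [hι]; exact gen_mem (fun i => (natS i, T i)) i.2⟩
    · exact ⟨1, by rw [map_one]; exact one_mem _⟩
    · rintro a b _ _ ⟨a', ha⟩ ⟨b', hb⟩
      exact ⟨a' * b', by rw [map_mul]; exact mul_mem ha hb⟩
  choose f hf using hex
  refine ⟨⟨⟨f, ?_⟩, ?_⟩, ?_⟩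
  · exact eq_snd_of_fst hT (hf 1) (one_mem _) (by simp)
  · intro a b
    exact eq_snd_of_fst hT (hf _) (mul_mem (hf a) (hf b)) (by simp)
  · intro i
    exact eq_snd_of_fst hT (hf _) (gen_mem (fun i => (natS i, T i)) i.2) (hι i)

end SymmetricGroup

section Diagrams

/-- The `2 n` endpoints of a Kauffman diagram are the left points `A_1, …, A_n` (`Sum.inl`) and the
right points `B_1, …, B_n` (`Sum.inr`). `boundaryPos` numbers them by `0, …, 2 n - 1` in the order
`A_1, …, A_n, B_n, …, B_1` in which they occur on the boundary of their convex hull. -/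
def boundaryPos {n : ℕ} : Fin n ⊕ Fin n → ℕ
  | Sum.inl i => i
  | Sum.inr i => 2 * n - 1 - i

theorem boundaryPos_injective {n : ℕ} : Function.Injective (boundaryPos (n := n)) := by
  rintro (⟨i, hi⟩ | ⟨i, hi⟩) (⟨j, hj⟩ | ⟨j, hj⟩) h <;> simp only [boundaryPos] at h <;>
    simp <;> omega

/-- A Kauffman diagram: a perfect matching of the `2 n` endpoints (`partner` sends an endpoint to the
other end of its edge) such that no two edges cross inside the convex hull of the endpoints. -/
@[ext]
structure KauffmanDiagram (n : ℕ) where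
  partner : Equiv.Perm (Fin n ⊕ Fin n)
  partner_partner : ∀ v, partner (partner v) = v
  partner_ne : ∀ v, partner v ≠ v
  noncrossing : ∀ u v, ¬ (boundaryPos u < boundaryPos v ∧
    boundaryPos v < boundaryPos (partner u) ∧ boundaryPos (partner u) < boundaryPos (partner v))

variable {n : ℕ}

/-- The smaller of the two indices `i`, `i + 1` attached to the `i`-th generator. -/
def lo (i : Fin (n - 1)) : Fin n := ⟨i, by omega⟩
/-- The larger of the two indices `i`, `i + 1` attached to the `i`-th generator. -/
def hi (i : Fin (n - 1)) : Fin n := ⟨i + 1, by omega⟩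

/-- The diagram of the identity: every `A_i` is joined to `B_i`. -/
def KauffmanDiagram.one (n : ℕ) : KauffmanDiagram n where
  partner := Equiv.sumComm _ _
  partner_partner := by rintro (i | i) <;> rfl
  partner_ne := by rintro (i | i) <;> simp
  noncrossing := by
    rintro (⟨i, h₁⟩ | ⟨i, h₁⟩) (⟨j, h₂⟩ | ⟨j, h₂⟩) <;> simp [boundaryPos] <;> omega

/-- The matching `p` with `b`, `b'` joined to each other and their former partners joined to each
other (see `rewire_apply`); nothing changes if `b` and `b'` were already joined. -/
def rewire {α : Type*} [DecidableEq α] (p : Equiv.Perm α) (b b' : α) : Equiv.Perm α :=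
  Equiv.swap b' (p b) * p * Equiv.swap b' (p b)

theorem rewire_apply {α : Type*} [DecidableEq α] (p : Equiv.Perm α) (hp : ∀ x, p (p x) = x)
    (hne : ∀ x, p x ≠ x) {b b' : α} (hb : b ≠ b') (x : α) :
    rewire p b b' x = if x = b then b' else if x = b' then b else
      if x = p b then p b' else if x = p b' then p b else p x := by
  simp only [rewire, Equiv.Perm.mul_apply, Equiv.swap_apply_def]
  grind

theorem rewire_noncrossing {α : Type*} [DecidableEq α] (pos : α → ℕ)
    (hpos : Function.Injective pos) (p : Equiv.Perm α) (hp : ∀ x, p (p x) = x)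
    (hne : ∀ x, p x ≠ x)
    (hnc : ∀ u v, ¬ (pos u < pos v ∧ pos v < pos (p u) ∧ pos (p u) < pos (p v)))
    {b b' : α} (hb : pos b = pos b' + 1) (u v : α) :
    ¬ (pos u < pos v ∧ pos v < pos (rewire p b b' u) ∧
      pos (rewire p b b' u) < pos (rewire p b b' v)) := by
  have hbb : b ≠ b' := by rintro rfl; omega
  have key : ∀ x y, x ≠ y → pos x ≠ pos y := fun x y h h' => h (hpos h')
  have cr : ∀ x y, (pos x < pos y ∧ pos y < pos (p x) → pos (p y) < pos (p x) ∧ pos x < pos (p y)) := by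
    intro x y ⟨h1, h2⟩
    have h3 := hnc x y
    have h4 := hnc (p y) x
    have h5 := hp y
    rw [h5] at h4
    have : y ≠ p x := by rintro rfl; omega
    have : p y ≠ p x := by intro h; have := p.injective h; subst this; omega
    have := key _ _ this
    have : p y ≠ x := by rintro rfl; simp_all
    have := key _ _ this
    omega
  have side : ∀ z, z ≠ b → z ≠ b' → z ≠ p b → z ≠ p b' →
      ¬ (pos (p b) < pos z ∧ pos z < pos (p b') ∧ pos (p b') < pos (p z)) ∧
      ¬ (pos (p b') < pos z ∧ pos z < pos (p b) ∧ pos (p b) < pos (p z)) ∧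
      ¬ (pos z < pos (p b) ∧ pos (p b) < pos (p z) ∧ pos (p z) < pos (p b')) ∧
      ¬ (pos z < pos (p b') ∧ pos (p b') < pos (p z) ∧ pos (p z) < pos (p b)) := by
    intro z h1 h2 h3 h4
    have k1 := key _ _ h1
    have k2 := key _ _ h2
    have k3 := key _ _ h3
    have k4 := key _ _ h4
    have k5 : pos (p z) ≠ pos b := key _ _ fun h => h3 (by rw [← h, hp])
    have k6 : pos (p z) ≠ pos b' := key _ _ fun h => h4 (by rw [← h, hp])
    have a1 := cr b z
    have a2 := cr b (p z)
    have a3 := cr (p b) z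
    have a4 := cr (p b) (p z)
    have a5 := cr b' z
    have a6 := cr b' (p z)
    have a7 := cr (p b') z
    have a8 := cr (p b') (p z)
    simp only [hp] at a1 a2 a3 a4 a5 a6 a7 a8
    have k7 := key _ _ (hne b)
    have k8 := key _ _ (hne b')
    have k9 := key _ _ (hne z)
    have k10 : pos (p z) ≠ pos (p b) := key _ _ fun h => h1 (p.injective h)
    have k11 : pos (p z) ≠ pos (p b') := key _ _ fun h => h2 (p.injective h)
    refine ⟨?_, ?_, ?_, ?_⟩ <;> omega
  rw [rewire_apply p hp hne hbb, rewire_apply p hp hne hbb]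
  have su := side u
  have sv := side v
  have ku : u ≠ b → u ≠ p b → pos (p u) ≠ pos b := fun _ h => key _ _ fun h' => h (by rw [← h', hp])
  have hnuv := hnc u v
  split_ifs <;> subst_vars <;> grind

/-- The diagram obtained by concatenating `D` with the diagram of the generator `t_i` on its right
and removing a loop if one is formed: `B_i` and `B_{i+1}` get joined, and so do their former
partners. -/
def KauffmanDiagram.mulGen (D : KauffmanDiagram n) (i : Fin (n - 1)) : KauffmanDiagram n where
  partner := rewire D.partner (Sum.inr (lo i)) (Sum.inr (hi i))
  partner_partner v := by simp [rewire, D.partner_partner]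
  partner_ne v := by
    simp only [rewire, Equiv.Perm.mul_apply, ne_eq, Equiv.swap_apply_eq_iff]
    exact D.partner_ne _
  noncrossing := rewire_noncrossing _ boundaryPos_injective _ D.partner_partner D.partner_ne
    D.noncrossing (by simp only [boundaryPos, lo, hi]; omega)

/-- The factor arising in the concatenation of `D` with `t_i`: a loop is formed exactly if `D` joins
`B_i` and `B_{i+1}`, and it contributes the factor `ξ`. -/
noncomputable def KauffmanDiagram.loopFactor (ξ : ℂ) (D : KauffmanDiagram n) (i : Fin (n - 1)) : ℂ :=
  if D.partner (Sum.inr (lo i)) = Sum.inr (hi i) then ξ else 1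

theorem KauffmanDiagram.mulGen_apply (D : KauffmanDiagram n) (i : Fin (n - 1)) (x) :
    (D.mulGen i).partner x = if x = Sum.inr (lo i) then Sum.inr (hi i) else
      if x = Sum.inr (hi i) then Sum.inr (lo i) else
      if x = D.partner (Sum.inr (lo i)) then D.partner (Sum.inr (hi i)) else
      if x = D.partner (Sum.inr (hi i)) then D.partner (Sum.inr (lo i)) else D.partner x :=
  rewire_apply D.partner D.partner_partner D.partner_ne (by simp [lo, hi]) x

/-- Right multiplication by `t_i` on the space with basis the Kauffman diagrams. -/
noncomputable def actGen (ξ : ℂ) (i : Fin (n - 1)) :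
    Module.End ℂ (KauffmanDiagram n →₀ ℂ) :=
  Finsupp.linearCombination ℂ fun D => Finsupp.single (D.mulGen i) (D.loopFactor ξ i)

theorem actGen_single (ξ : ℂ) (i : Fin (n - 1)) (D : KauffmanDiagram n) (c : ℂ) :
    actGen ξ i (Finsupp.single D c) =
      Finsupp.single (D.mulGen i) (c * D.loopFactor ξ i) := by
  simp [actGen]

theorem actGen_sq (ξ : ℂ) (i : Fin (n - 1)) : actGen ξ i * actGen ξ i = ξ • actGen ξ i := by
  have hlh : (Sum.inr (lo i) : Fin n ⊕ Fin n) ≠ Sum.inr (hi i) := by simp [lo, hi]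
  refine Finsupp.lhom_ext fun D c => ?_
  simp only [Module.End.mul_apply, actGen_single, LinearMap.smul_apply, Finsupp.smul_single]
  have h1 : (D.mulGen i).mulGen i = D.mulGen i := by
    ext1; ext1 x
    simp only [KauffmanDiagram.mulGen_apply]
    grind
  have h2 : (D.mulGen i).loopFactor ξ i = ξ := by
    simp [KauffmanDiagram.loopFactor, KauffmanDiagram.mulGen_apply]
  rw [h1, h2, smul_eq_mul]; congr 1; ring

theorem actGen_braid (ξ : ℂ) (i j : Fin (n - 1)) (h : (i : ℕ) + 1 = j ∨ (j : ℕ) + 1 = i) :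
    actGen ξ i * (actGen ξ j * actGen ξ i) = actGen ξ i := by
  have hi' : (Sum.inr (lo i) : Fin n ⊕ Fin n) ≠ Sum.inr (hi i) := by simp [lo, hi]
  have hj' : (Sum.inr (lo j) : Fin n ⊕ Fin n) ≠ Sum.inr (hi j) := by simp [lo, hi]
  have hij : (hi i = lo j ∧ (Sum.inr (lo i) : Fin n ⊕ Fin n) ≠ Sum.inr (hi j)) ∨
      (hi j = lo i ∧ (Sum.inr (lo j) : Fin n ⊕ Fin n) ≠ Sum.inr (hi i)) := by
    simp [lo, hi]; omega
  refine Finsupp.lhom_ext fun D c => ?_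
  have e := D.partner_partner
  have ne := D.partner_ne
  have h1 : ((D.mulGen i).mulGen j).mulGen i = D.mulGen i := by
    ext1; ext1 x
    rcases hij with ⟨h, h'⟩ | ⟨h, h'⟩ <;>
    · simp only [KauffmanDiagram.mulGen_apply, h] at *
      grind
  have h2 : (D.mulGen i).loopFactor ξ j * ((D.mulGen i).mulGen j).loopFactor ξ i = 1 := by
    rcases hij with ⟨h, h'⟩ | ⟨h, h'⟩ <;>
    · simp only [KauffmanDiagram.loopFactor, KauffmanDiagram.mulGen_apply, h] at *
      grind
  simp only [Module.End.mul_apply, actGen_single]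
  rw [h1, mul_assoc, h2, mul_one]

theorem actGen_comm (ξ : ℂ) (i j : Fin (n - 1)) (h : (i : ℕ) + 2 ≤ j ∨ (j : ℕ) + 2 ≤ i) :
    actGen ξ i * actGen ξ j = actGen ξ j * actGen ξ i := by
  have hi' : (Sum.inr (lo i) : Fin n ⊕ Fin n) ≠ Sum.inr (hi i) := by simp [lo, hi]
  have hj' : (Sum.inr (lo j) : Fin n ⊕ Fin n) ≠ Sum.inr (hi j) := by simp [lo, hi]
  have g1 : (Sum.inr (lo i) : Fin n ⊕ Fin n) ≠ Sum.inr (hi j) := by simp [lo, hi]; omega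
  have g2 : (Sum.inr (lo i) : Fin n ⊕ Fin n) ≠ Sum.inr (lo j) := by
    simp [lo, Fin.ext_iff]; omega
  have g3 : (Sum.inr (hi i) : Fin n ⊕ Fin n) ≠ Sum.inr (hi j) := by
    simp [hi, Fin.ext_iff]; omega
  have g4 : (Sum.inr (hi i) : Fin n ⊕ Fin n) ≠ Sum.inr (lo j) := by simp [lo, hi]; omega
  refine Finsupp.lhom_ext fun D c => ?_
  have e := D.partner_partner
  have ne := D.partner_ne
  have h1 : (D.mulGen i).mulGen j = (D.mulGen j).mulGen i := by
    ext1; ext1 x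
    simp only [KauffmanDiagram.mulGen_apply, g1, g2, g3, g4, g1.symm, g2.symm, g3.symm, g4.symm,
      if_false]
    by_cases c1 : D.partner (Sum.inr (lo i)) = Sum.inr (lo j) <;>
    by_cases c2 : D.partner (Sum.inr (lo i)) = Sum.inr (hi j) <;>
    by_cases c3 : D.partner (Sum.inr (hi i)) = Sum.inr (lo j) <;>
    by_cases c4 : D.partner (Sum.inr (hi i)) = Sum.inr (hi j) <;>
    grind (splits := 20)
  have h2 : D.loopFactor ξ i * (D.mulGen i).loopFactor ξ j =
      D.loopFactor ξ j * (D.mulGen j).loopFactor ξ i := by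
    simp only [KauffmanDiagram.loopFactor, KauffmanDiagram.mulGen_apply]
    grind
  simp only [Module.End.mul_apply, actGen_single]
  rw [mul_assoc, mul_assoc, h1, h2]

end Diagrams

section TemperleyLieb

/-- The defining relations of the Temperley--Lieb algebra. The index `i : Fin (n - 1)` stands for
the generator written `t_{i+1}` when the generators are numbered from `1` to `n - 1`. -/
inductive TLRel (ξ : ℂ) (n : ℕ) :
    FreeAlgebra ℂ (Fin (n - 1)) → FreeAlgebra ℂ (Fin (n - 1)) → Prop
  | sq (i : Fin (n - 1)) :
      TLRel ξ n (FreeAlgebra.ι ℂ i * FreeAlgebra.ι ℂ i) (ξ • FreeAlgebra.ι ℂ i)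
  | braid (i j : Fin (n - 1)) (h : (i : ℕ) + 1 = j ∨ (j : ℕ) + 1 = i) :
      TLRel ξ n (FreeAlgebra.ι ℂ i * FreeAlgebra.ι ℂ j * FreeAlgebra.ι ℂ i) (FreeAlgebra.ι ℂ i)
  | comm (i j : Fin (n - 1)) (h : (i : ℕ) + 2 ≤ j ∨ (j : ℕ) + 2 ≤ i) :
      TLRel ξ n (FreeAlgebra.ι ℂ i * FreeAlgebra.ι ℂ j) (FreeAlgebra.ι ℂ j * FreeAlgebra.ι ℂ i)

/-- The Temperley--Lieb algebra `TL_n(ξ)`, by generators and relations. -/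
abbrev TL (ξ : ℂ) (n : ℕ) : Type := RingQuot (TLRel ξ n)

/-- The generators of `TL_n(ξ)`. -/
noncomputable def TL.t (ξ : ℂ) (n : ℕ) (i : Fin (n - 1)) : TL ξ n :=
  RingQuot.mkAlgHom ℂ (TLRel ξ n) (FreeAlgebra.ι ℂ i)

theorem TL.t_sq (ξ : ℂ) {n : ℕ} (i : Fin (n - 1)) : t ξ n i * t ξ n i = ξ • t ξ n i := by
  simpa [t] using RingQuot.mkAlgHom_rel ℂ (TLRel.sq (ξ := ξ) (n := n) i)

theorem TL.t_braid (ξ : ℂ) {n : ℕ} (i j : Fin (n - 1)) (h : (i : ℕ) + 1 = j ∨ (j : ℕ) + 1 = i) :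
    t ξ n i * t ξ n j * t ξ n i = t ξ n i := by
  simpa [t] using RingQuot.mkAlgHom_rel ℂ (TLRel.braid (ξ := ξ) (n := n) i j h)

theorem TL.t_comm (ξ : ℂ) {n : ℕ} (i j : Fin (n - 1)) (h : (i : ℕ) + 2 ≤ j ∨ (j : ℕ) + 2 ≤ i) :
    t ξ n i * t ξ n j = t ξ n j * t ξ n i := by
  simpa [t] using RingQuot.mkAlgHom_rel ℂ (TLRel.comm (ξ := ξ) (n := n) i j h)

/-- The right action of `TL_n(ξ)` on the space with basis the Kauffman diagrams, in which the
generators act by concatenation. -/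
noncomputable def TL.rightAction (ξ : ℂ) (n : ℕ) :
    TL ξ n →ₐ[ℂ] (Module.End ℂ (KauffmanDiagram n →₀ ℂ))ᵐᵒᵖ :=
  RingQuot.liftAlgHom ℂ
    ⟨FreeAlgebra.lift ℂ fun i => MulOpposite.op (actGen ξ i), by
      intro x y h
      cases h with
      | sq i => simp [← MulOpposite.op_mul, actGen_sq]
      | braid i j h => simp [← MulOpposite.op_mul, actGen_braid ξ i j h]
      | comm i j h => simp [← MulOpposite.op_mul, actGen_comm ξ i j h]⟩

theorem TL.rightAction_t (ξ : ℂ) {n : ℕ} (i : Fin (n - 1)) :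
    rightAction ξ n (t ξ n i) = MulOpposite.op (actGen ξ i) := by
  simp [rightAction, t]

/-- The expansion of an element `x` of `TL_n(ξ)` in the basis of Kauffman diagrams: `x` is
multiplied from the right to the identity diagram. The diagrams label a basis of `TL_n(ξ)` in such
a way that multiplication is concatenation, with a factor `ξ` for each loop, so that
`x = 1 * x` is the combination of basis elements given by `x.expand`. -/
noncomputable def TL.expand {ξ : ℂ} {n : ℕ} (x : TL ξ n) : KauffmanDiagram n →₀ ℂ :=
  (rightAction ξ n x).unop (Finsupp.single (KauffmanDiagram.one n) 1)

/-- The diagram of `τ(I) = ∏_{i ∈ I} t_i`, the product taken in increasing order from left to right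
(no loops are formed, see `TL.expand_prod_t`). An element `i : Fin (n - 1)` of `I` stands for the
element `i + 1` of `[n - 1] = {1, …, n - 1}`. -/
def tau {n : ℕ} (I : Finset (Fin (n - 1))) : KauffmanDiagram n :=
  (I.sort (· ≤ ·)).foldl KauffmanDiagram.mulGen (KauffmanDiagram.one n)

theorem TL.expand_prod_t {ξ : ℂ} {n : ℕ} (I : Finset (Fin (n - 1))) :
    TL.expand (((I.sort (· ≤ ·)).map (TL.t ξ n)).prod) = Finsupp.single (tau I) 1 := by
  have key : ∀ (l : List (Fin (n - 1))) (D : KauffmanDiagram n), l.Pairwise (· < ·) →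
      (∀ i ∈ l, D.partner (Sum.inr (hi i)) = Sum.inl (hi i)) →
      (rightAction ξ n ((l.map (TL.t ξ n)).prod)).unop (Finsupp.single D 1) =
        Finsupp.single (l.foldl KauffmanDiagram.mulGen D) 1 := by
    intro l
    induction l with
    | nil => intro D _ _; simp
    | cons i l ih =>
      intro D hl hD
      rw [List.pairwise_cons] at hl
      have hi1 := hD i (by simp)
      have hloop : D.loopFactor ξ i = 1 := by
        rw [KauffmanDiagram.loopFactor, if_neg]
        intro h
        have := D.partner_partner (Sum.inr (lo i))
        rw [h, hi1] at this
        cases this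
      simp only [List.map_cons, List.prod_cons, map_mul, rightAction_t, MulOpposite.unop_mul,
        Module.End.mul_apply, MulOpposite.unop_op, actGen_single, hloop, mul_one, List.foldl_cons]
      refine ih _ hl.2 fun j hj => ?_
      have hij := hl.1 j hj
      have hj1 := hD j (by simp [hj])
      rw [KauffmanDiagram.mulGen_apply, if_neg, if_neg, if_neg, if_neg, hj1]
      · intro h
        rw [h, D.partner_partner] at hj1
        cases hj1
      · intro h
        rw [h, D.partner_partner] at hj1
        cases hj1
      · simp only [hi, Sum.inr.injEq, Fin.ext_iff]; omega
      · simp only [hi, lo, Sum.inr.injEq, Fin.ext_iff]; omega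
  exact key _ _ (Finset.sortedLT_sort I).pairwise (fun i _ => rfl)

/-- The simple transposition `s_i = (i, i + 1)`. -/
def simpleTransposition {n : ℕ} (i : Fin (n - 1)) : Equiv.Perm (Fin n) := Equiv.swap (lo i) (hi i)

theorem exists_theta (n : ℕ) :
    ∃ θ : MonoidAlgebra ℂ (Equiv.Perm (Fin n))ᵐᵒᵖ →ₐ[ℂ] TL 2 n,
      ∀ i : Fin (n - 1), θ (MonoidAlgebra.of ℂ _ (MulOpposite.op (simpleTransposition i))) =
        TL.t 2 n i - 1 := by
  suffices h : ∃ φ : Equiv.Perm (Fin n) →* TL 2 n,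
      ∀ i : Fin (n - 1), φ (simpleTransposition i) = TL.t 2 n i - 1 by
    obtain ⟨φ, hφ⟩ := h
    refine ⟨MonoidAlgebra.lift ℂ _ _
      (φ.comp (MulEquiv.inv' (Equiv.Perm (Fin n))).symm.toMonoidHom), fun i => ?_⟩
    rw [MonoidAlgebra.of_apply, MonoidAlgebra.lift_single, one_smul, ← hφ]
    simp [simpleTransposition]
  cases n with
  | zero => exact ⟨1, fun i => i.elim0⟩
  | succ n =>
    let T : ℕ → TL 2 (n + 1) := fun i => if h : i < n then TL.t 2 (n + 1) ⟨i, h⟩ - 1 else 1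
    have hT : ∀ i (h : i < n), T i = TL.t 2 (n + 1) ⟨i, h⟩ - 1 := fun i h => dif_pos h
    obtain ⟨φ, hφ⟩ := exists_permHom n T
      { sq := by
          intro i h
          have h1 := TL.t_sq 2 (n := n + 1) ⟨i, h⟩
          rw [hT i h, mul_sub, sub_mul, h1, two_smul]
          noncomm_ring
        braid := by
          intro i h
          have h1 := TL.t_sq 2 (n := n + 1) ⟨i, by simp; omega⟩
          have h2 := TL.t_sq 2 (n := n + 1) ⟨i + 1, h⟩
          have h3 := TL.t_braid 2 (n := n + 1) ⟨i, by simp; omega⟩ ⟨i + 1, h⟩ (by simp)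
          have h4 := TL.t_braid 2 (n := n + 1) ⟨i + 1, h⟩ ⟨i, by simp; omega⟩ (by simp)
          rw [hT i (by omega), hT (i + 1) h]
          generalize TL.t 2 (n + 1) ⟨i, _⟩ = a at *
          generalize TL.t 2 (n + 1) ⟨i + 1, _⟩ = b at *
          rw [two_smul] at h1 h2
          have e1 : (a - 1) * (b - 1) * (a - 1) =
            a * b * a - a * b - b * a + b - a * a + a + a - 1 := by
            simp only [mul_sub, sub_mul, mul_one, one_mul]; abel
          have e2 : (b - 1) * (a - 1) * (b - 1) =
            b * a * b - a * b - b * a + a - b * b + b + b - 1 := by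
            simp only [mul_sub, sub_mul, mul_one, one_mul]; abel
          rw [e1, e2, h1, h2, h3, h4]
          abel
        comm := by
          intro i j h hj
          rw [hT i (by omega), hT j hj]
          have h1 := TL.t_comm 2 (n := n + 1) ⟨i, by simp; omega⟩ ⟨j, hj⟩ (by simp; omega)
          simp only [mul_sub, sub_mul, mul_one, one_mul, h1]; abel }
    refine ⟨φ, fun i => ?_⟩
    rw [← hT i i.2, ← hφ i]
    rfl

/-- The homomorphism of algebras `θ : ℂ[S_n] → TL_n(2)` with `θ(s_i) = t_i - 1`. Permutations are
composed from left to right, so `S_n` is the opposite of Mathlib's group of permutations. -/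
noncomputable def theta (n : ℕ) : MonoidAlgebra ℂ (Equiv.Perm (Fin n))ᵐᵒᵖ →ₐ[ℂ] TL 2 n :=
  Classical.choose (exists_theta n)

theorem theta_simpleTransposition {n : ℕ} (i : Fin (n - 1)) :
    theta n (MonoidAlgebra.of ℂ _ (MulOpposite.op (simpleTransposition i))) = TL.t 2 n i - 1 :=
  Classical.choose_spec (exists_theta n) i

/-- `f_τ(w)`, the coefficient of the diagram `τ` in `θ(w)`. -/
noncomputable def tlCoeff {n : ℕ} (τ : KauffmanDiagram n) (w : Equiv.Perm (Fin n)) : ℂ :=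
  (theta n (MonoidAlgebra.of ℂ _ (MulOpposite.op w))).expand τ

/-- The `f`-immanant of a matrix. -/
def immanant {A : Type*} [CommRing A] [Algebra ℂ A] {n : ℕ} (f : Equiv.Perm (Fin n) → ℂ)
    (M : Matrix (Fin n) (Fin n) A) : A :=
  ∑ w : Equiv.Perm (Fin n), f w • ∏ i, M i (w i)

/-- The Temperley--Lieb immanant for the Kauffman diagram `τ`. -/
noncomputable def tlImmanant {A : Type*} [CommRing A] [Algebra ℂ A] {n : ℕ}
    (τ : KauffmanDiagram n) (M : Matrix (Fin n) (Fin n) A) : A :=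
  immanant (tlCoeff τ) M

end TemperleyLieb

section SkewShapes

/-- A skew shape `λ/μ`, given by the pair of partitions `μ ⊆ λ`. Rows and columns of Young diagrams
are numbered from `0`, so `outer.rowLen i` is `λ_{i+1}`. -/
@[ext]
structure SkewShape where
  outer : YoungDiagram
  inner : YoungDiagram
  le : inner ≤ outer

namespace SkewShape

/-- The cells of `λ/μ`, as pairs (row, column). -/
def cells (R : SkewShape) : Finset (ℕ × ℕ) := R.outer.cells \ R.inner.cells

/-- The number of cells. -/
def size (R : SkewShape) : ℕ := R.cells.card

/-- The length `ℓ(λ)`, the number of nonzero parts of the outer partition. -/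
def length (R : SkewShape) : ℕ := R.outer.colLen 0

/-- The conjugate `λ'/μ'`. -/
def conjugate (R : SkewShape) : SkewShape where
  outer := R.outer.transpose
  inner := R.inner.transpose
  le := YoungDiagram.transpose_le_iff.mpr R.le

/-- Two cells share an edge. -/
def Adjacent (a b : ℕ × ℕ) : Prop :=
  (a.1 = b.1 ∧ (a.2 + 1 = b.2 ∨ b.2 + 1 = a.2)) ∨ (a.2 = b.2 ∧ (a.1 + 1 = b.1 ∨ b.1 + 1 = a.1))

/-- Any two cells are joined by a chain of adjacent cells. -/
def IsConnected (R : SkewShape) : Prop :=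
  ∀ a ∈ R.cells, ∀ b ∈ R.cells, Relation.ReflTransGen (fun c d => d ∈ R.cells ∧ Adjacent c d) a b

/-- A ribbon: a connected skew shape that contains no `2 × 2` block of cells. -/
def IsRibbon (R : SkewShape) : Prop :=
  R.IsConnected ∧ ∀ i j, ¬ ((i, j) ∈ R.cells ∧ (i, j + 1) ∈ R.cells ∧
    (i + 1, j) ∈ R.cells ∧ (i + 1, j + 1) ∈ R.cells)

/-- The set `𝓡_m` of ribbons `λ/μ` of size `m` with `{i : λ_i > μ_i} = [ℓ(λ)]`. -/
def ribbons (m : ℕ) : Set SkewShape :=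
  {R | R.IsRibbon ∧ R.size = m ∧ ∀ i, R.inner.rowLen i < R.outer.rowLen i ↔ i < R.length}

/-- The label of a cell of a ribbon when its cells are labelled sequentially by `1, 2, …`, starting
from the top-right cell: the number of cells that are in a higher row, or in the same row and not
further left. -/
def label (R : SkewShape) (c : ℕ × ℕ) : ℕ :=
  (R.cells.filter fun d => d.1 < c.1 ∨ (d.1 = c.1 ∧ c.2 ≤ d.2)).card

/-- The descent set of a ribbon: the `i` such that the cell labelled `i` is immediately above the
cell labelled `i + 1`. -/
def Des (R : SkewShape) : Set ℕ :=
  {i | ∃ r c, (r, c) ∈ R.cells ∧ (r + 1, c) ∈ R.cells ∧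
    R.label (r, c) = i ∧ R.label (r + 1, c) = i + 1}

/-- `d(J, R) = {∑_{j=1}^i (λ_j - μ_j) : i ∈ J}`. -/
def d (J : Set ℕ) (R : SkewShape) : Set ℕ :=
  (fun i => ∑ j ∈ Finset.range i, (R.outer.rowLen j - R.inner.rowLen j)) '' J

end SkewShape

end SkewShapes

section SymmetricFunctions

variable {σ : Type*}

open Classical in
/-- The elementary symmetric function `e_d(x_1, x_2, …)`, as a formal power series, in the infinite
sequence of variables `x : ℕ ↪ σ`: the sum of all products of `d` distinct variables of the
sequence. In particular `e_0 = 1`, and `e_d = 0` for `d < 0`. -/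
noncomputable def elemSymm (x : ℕ ↪ σ) (d : ℤ) : MvPowerSeries σ ℂ :=
  fun a => if (a.degree : ℤ) = d ∧ (∀ v, a v ≤ 1) ∧ (∀ v ∈ a.support, v ∈ Set.range x)
    then 1 else 0

/-- The (dual) Jacobi--Trudi matrix `JT^n_{λ/μ}(x) = (e_{λ_i - μ_j - i + j}(x))_{i,j=1}^n`. -/
noncomputable def JT (n : ℕ) (R : SkewShape) (x : ℕ ↪ σ) :
    Matrix (Fin n) (Fin n) (MvPowerSeries σ ℂ) :=
  Matrix.of fun i j =>
    elemSymm x ((R.outer.rowLen i : ℤ) - (R.inner.rowLen j : ℤ) - (i : ℤ) + (j : ℤ))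

/-- The skew Schur function
`s_{λ/μ}(x) = det (e_{λ'_i - μ'_j - i + j}(x))_{i,j=1}^{ℓ(λ')}`. -/
noncomputable def skewSchur (R : SkewShape) (x : ℕ ↪ σ) : MvPowerSeries σ ℂ :=
  (JT R.conjugate.length R.conjugate x).det

/-- The Hadamard (entrywise) product of a family of matrices. -/
def hadamardProd {A : Type*} [CommRing A] {k n : ℕ} (M : Fin k → Matrix (Fin n) (Fin n) A) :
    Matrix (Fin n) (Fin n) A :=
  Matrix.of fun i j => ∏ p, M p i j

/-- The sequence of variables `x^{(p)} = (x^{(p)}_1, x^{(p)}_2, …)`, among `k` disjoint infinite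
sequences of variables. -/
def alphabet {k : ℕ} (p : Fin k) : ℕ ↪ Fin k × ℕ :=
  ⟨fun j => (p, j), fun _ _ h => congrArg Prod.snd h⟩

end SymmetricFunctions

end TLImm

namespace TLImm

open Finset

/-! ### Permutations that survive in an upper Hessenberg matrix -/

section SortedProducts

/-! Number rows from 0. Consecutive nonempty rows of a ribbon overlap in exactly one column, so
λ_{i+1} = μ_i + 1 (`outer_rowLen_succ`). Hence the Jacobi–Trudi matrix is upper Hessenberg: its
subdiagonal entries are e_0 = 1 between nonempty rows and 0 further down, and for v ≤ b < ℓ the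
entry (v, b) is e_d, where d is the number of cells in rows v, …, b (`jacobiTrudi_index`).

In an immanant of a Hessenberg matrix only permutations with w(i+1) ≥ i for all i contribute. They
are exactly the products w_J of simple transpositions s_j, j ∈ J, in increasing order, one for each
set J (`exists_sortedPerm`, `sortedPerm_injective`). Since θ(w_J) = ∏_{j ∈ J} (t_j - 1) in that
order, expanding creates no loops and gives the sum of (-1)^{|J \ I|} τ(I) over I ⊆ J
(`expand_theta_sortedPerm`), with pairwise distinct τ(I). All other diagrams have coefficient 0,
which is the vanishing statement.

The matrix product along w_J is 0 unless every j ∈ J joins two nonempty rows. In that case J merges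
consecutive rows into blocks, and the product is ∏ e_{block size}; as a function of the cut points
this is `blockProd` (`prod_shapeMatrix`). Thus the immanant of τ(I) is an alternating sum over J ⊇
I, equivalently over all subsets D of the set T of partial row sums at the cuts outside I
(`coarseningSum`). The determinant is the same sum with I = ∅, because sign(w_J) = (-1)^{|J|}. For
R_I the set of all cuts is its descent set (`Des_eq`), which is T by hypothesis, so the two sides
agree.

The argument uses of e_d only that E(0) = 1 and E(d) = 0 for d < 0. Both survive products over k ≥ 1
alphabets, so it is carried out for an arbitrary such E. -/

theorem sort_insert_max {α : Type*} [LinearOrder α] {s : Finset α} {a : α}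
    (h : ∀ x ∈ s, x < a) : (insert a s).sort (· ≤ ·) = s.sort (· ≤ ·) ++ [a] := by
  have ha : a ∉ s := fun h' => lt_irrefl _ (h a h')
  refine List.Perm.eq_of_pairwise' (r := (· ≤ ·)) (pairwise_sort _ _) ?_ ?_
  · refine List.pairwise_append.2 ⟨pairwise_sort _ _, by simp, ?_⟩
    intro x hx y hy
    rw [mem_sort] at hx
    rw [List.mem_singleton] at hy
    exact hy ▸ (h x hx).le
  · rw [List.perm_ext_iff_of_nodup (sort_nodup _ _)]
    · intro x
      simp [or_comm]
    · rw [List.nodup_append]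
      refine ⟨sort_nodup _ _, by simp, ?_⟩
      intro x hx y hy
      rw [mem_sort] at hx
      rw [List.mem_singleton] at hy
      exact hy ▸ (h x hx).ne

variable {n : ℕ}

/-- The product of the simple transpositions `s_i`, `i ∈ J`, in increasing order, where permutations
are composed from left to right. -/
def sortedPerm (J : Finset (Fin (n - 1))) : Equiv.Perm (Fin n) :=
  (((J.sort (· ≤ ·)).map fun i => MulOpposite.op (simpleTransposition i)).prod).unop

theorem sortedPerm_empty : sortedPerm (∅ : Finset (Fin (n - 1))) = 1 := by simp [sortedPerm]

theorem sortedPerm_insert_max {J : Finset (Fin (n - 1))} {a : Fin (n - 1)} (h : ∀ i ∈ J, i < a) :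
    sortedPerm (insert a J) = simpleTransposition a * sortedPerm J := by
  simp [sortedPerm, sort_insert_max h]

theorem tau_empty : tau (∅ : Finset (Fin (n - 1))) = KauffmanDiagram.one n := by simp [tau]

theorem tau_insert_max {J : Finset (Fin (n - 1))} {a : Fin (n - 1)} (h : ∀ i ∈ J, i < a) :
    tau (insert a J) = (tau J).mulGen a := by
  simp [tau, sort_insert_max h]

theorem lo_ne_hi (i : Fin (n - 1)) : lo i ≠ hi i := by simp [lo, hi]

theorem simpleTransposition_apply (a : Fin (n - 1)) (v : Fin n) :
    simpleTransposition a v = if v = lo a then hi a else if v = hi a then lo a else v :=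
  Equiv.swap_apply_def _ _ _

/-- The values of `sortedPerm J`: it maps `i + 1` to `i` for `i ∈ J`, and every other `v` to the
smallest `b ≥ v` that is not in `J`. -/
theorem sortedPerm_spec (J : Finset (Fin (n - 1))) :
    (∀ i ∈ J, sortedPerm J (hi i) = lo i) ∧
    ∀ v : Fin n, (∀ i ∈ J, hi i ≠ v) → v ≤ sortedPerm J v ∧
      (∀ b : Fin n, v ≤ b → b < sortedPerm J v → ∃ i ∈ J, lo i = b) ∧
      ∀ i ∈ J, lo i ≠ sortedPerm J v := by
  induction J using Finset.induction_on_max with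
  | empty =>
    refine ⟨by simp, fun v _ => ⟨by rw [sortedPerm_empty]; rfl, fun b hb hb' => absurd hb' ?_, by simp⟩⟩
    rw [sortedPerm_empty]
    exact hb.not_gt
  | insert a J h ih =>
    obtain ⟨ih1, ih2⟩ := ih
    rw [sortedPerm_insert_max h]
    have hia : ∀ i ∈ J, hi i ≠ hi a := fun i hi' he => by
      have := h i hi'; simp only [hi, Fin.ext_iff, Fin.lt_def] at *; omega
    -- All factors for `J` lie below `a`, so they leave `hi a` in place. The factor for `a`, applied
    -- last, then sends `hi a` to `lo a` and redirects to `hi a` whatever had landed on `lo a`.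
    have hfix : sortedPerm J (hi a) = hi a := by
      obtain ⟨h1, h2, -⟩ := ih2 (hi a) hia
      by_contra hne
      obtain ⟨i, hi', he⟩ := h2 (hi a) le_rfl (lt_of_le_of_ne h1 (Ne.symm hne))
      have := h i hi'; simp only [lo, hi, Fin.ext_iff, Fin.lt_def] at *; omega
    refine ⟨fun i hi' => ?_, fun v hv => ?_⟩
    · rw [Equiv.Perm.mul_apply, simpleTransposition_apply]
      rcases mem_insert.1 hi' with rfl | hi'
      · rw [hfix, if_neg (lo_ne_hi i).symm, if_pos rfl]
      · have := h i hi'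
        rw [ih1 i hi', if_neg, if_neg] <;>
        · simp only [lo, hi, Fin.ext_iff, Fin.lt_def] at *; omega
    · have hva : v ≠ hi a := fun he => hv a (mem_insert_self _ _) he.symm
      obtain ⟨h1, h2, h3⟩ := ih2 v fun i hi' => hv i (mem_insert_of_mem hi')
      rw [Equiv.Perm.mul_apply, simpleTransposition_apply]
      have hne : sortedPerm J v ≠ hi a := fun he => hva ((sortedPerm J).injective (he.trans hfix.symm))
      rw [if_neg hne]
      split_ifs with hc
      · rw [hc] at h1 h2
        refine ⟨h1.trans (by simp [lo, hi]), fun b hb hb' => ?_, fun i hi' => ?_⟩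
        · rcases eq_or_ne b (lo a) with rfl | hba
          · exact ⟨a, mem_insert_self _ _, rfl⟩
          · obtain ⟨i, hi', he⟩ := h2 b hb (by
              simp only [lo, hi, Fin.ext_iff, Fin.lt_def, ne_eq] at *; omega)
            exact ⟨i, mem_insert_of_mem hi', he⟩
        · rcases mem_insert.1 hi' with rfl | hi'
          · exact lo_ne_hi i
          · have := h i hi'
            simp only [lo, hi, Fin.ext_iff, Fin.lt_def, ne_eq] at *; omega
      · refine ⟨h1, fun b hb hb' => ?_, fun i hi' => ?_⟩
        · obtain ⟨i, hi', he⟩ := h2 b hb hb'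
          exact ⟨i, mem_insert_of_mem hi', he⟩
        · rcases mem_insert.1 hi' with rfl | hi'
          · exact Ne.symm hc
          · exact h3 i hi'

theorem mem_iff_sortedPerm_hi {J : Finset (Fin (n - 1))} {i : Fin (n - 1)} :
    i ∈ J ↔ sortedPerm J (hi i) = lo i := by
  refine ⟨(sortedPerm_spec J).1 i, fun h => by_contra fun hi' => ?_⟩
  have := ((sortedPerm_spec J).2 (hi i) fun j hj he => hi' ?_).1
  · rw [h] at this; simp [lo, hi, Fin.le_def] at this
  · rwa [show i = j by simpa [hi, Fin.ext_iff] using he.symm]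

theorem sortedPerm_injective : Function.Injective (sortedPerm (n := n)) := fun J K h => by
  ext i; rw [mem_iff_sortedPerm_hi, mem_iff_sortedPerm_hi, h]

/-- Look at the largest point r + 1 that may be moved. It cannot go up, since everything above is
fixed, and by hypothesis it goes down by at most one. If it goes to r, composing with the
transposition of r and r + 1 afterwards fixes it and keeps the hypothesis, so that transposition is
the last factor. -/
theorem exists_sortedPerm {w : Equiv.Perm (Fin n)} (hw : ∀ i, lo i ≤ w (hi i)) :
    ∃ J, sortedPerm J = w := by
  suffices h : ∀ r : ℕ, ∀ w : Equiv.Perm (Fin n), (∀ i, lo i ≤ w (hi i)) →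
      (∀ v : Fin n, r < v → w v = v) →
      ∃ J : Finset (Fin (n - 1)), (∀ i ∈ J, (i : ℕ) < r) ∧ sortedPerm J = w by
    obtain ⟨J, -, h⟩ := h n w hw (fun v hv => absurd v.2 (by omega))
    exact ⟨J, h⟩
  clear hw w
  intro r
  induction r with
  | zero =>
    refine fun w _ hfix => ⟨∅, by simp, ?_⟩
    rw [sortedPerm_empty]
    ext v
    by_contra hne
    rcases Nat.eq_zero_or_pos (v : ℕ) with h0 | h0
    · have h1 : (0 : ℕ) < (w v : ℕ) := by
        rw [Equiv.Perm.one_apply, h0] at hne; omega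
      exact hne (by rw [w.injective (hfix _ h1)]; rfl)
    · exact hne (by rw [hfix v h0]; rfl)
  | succ r ih =>
    intro w hw hfix
    by_cases hr : r + 1 < n
    · have hle : ∀ v : Fin n, (v : ℕ) ≤ r + 1 → (w v : ℕ) ≤ r + 1 := by
        intro v hv
        by_contra hc
        have := w.injective (hfix (w v) (by omega))
        rw [this] at hc; omega
      let a : Fin (n - 1) := ⟨r, by omega⟩
      have hwa := hw a
      have hla := hle (hi a) le_rfl
      by_cases hwr : w (hi a) = hi a
      · obtain ⟨J, hJ, rfl⟩ := ih w hw fun v hv => by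
          rcases eq_or_ne v (hi a) with rfl | hne
          · exact hwr
          · refine hfix v ?_
            simp only [a, hi, ne_eq, Fin.ext_iff] at hne; omega
        exact ⟨J, fun i hi' => (hJ i hi').trans (by omega), rfl⟩
      · have hwr : w (hi a) = lo a := by
          simp only [a, lo, hi, Fin.ext_iff, Fin.le_def] at *; omega
        have hess : ∀ i, lo i ≤ (simpleTransposition a * w) (hi i) := by
          intro i
          rw [Equiv.Perm.mul_apply, simpleTransposition_apply]
          have h1 := hw i
          split_ifs with c1 c2
          · rw [c1] at h1; exact h1.trans (by simp [lo, hi])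
          · have h3 : hi i ≠ hi a := fun h => lo_ne_hi a (by rw [← hwr, ← h, c2, h])
            have h2 : (hi i : ℕ) ≤ r + 1 := by
              by_contra hc
              have := hfix (hi i) (by omega)
              rw [c2] at this
              exact h3 this.symm
            simp only [a, lo, hi, Fin.ext_iff, Fin.le_def, ne_eq] at *; omega
          · exact h1
        have hfix' : ∀ v : Fin n, r < v → (simpleTransposition a * w) v = v := by
          intro v hv
          rw [Equiv.Perm.mul_apply, simpleTransposition_apply]
          rcases eq_or_ne v (hi a) with rfl | hne
          · rw [if_pos hwr]
          · have h1 := hfix v (by simp only [a, hi, ne_eq, Fin.ext_iff] at hne; omega)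
            rw [h1, if_neg, if_neg hne]
            simp only [a, lo, Fin.ext_iff]; omega
        obtain ⟨J, hJ, hJw⟩ := ih (simpleTransposition a * w) hess hfix'
        refine ⟨insert a J, ?_, ?_⟩
        · intro i hi'
          rcases mem_insert.1 hi' with rfl | hi'
          · exact Nat.lt_succ_self r
          · exact (hJ i hi').trans (Nat.lt_succ_self r)
        · rw [sortedPerm_insert_max hJ, hJw, ← mul_assoc, simpleTransposition,
            Equiv.swap_mul_self, one_mul]
    · obtain ⟨J, hJ, rfl⟩ := ih w hw fun v hv => absurd v.2 (by omega)
      exact ⟨J, fun i hi' => (hJ i hi').trans (by omega), rfl⟩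

theorem sign_sortedPerm (J : Finset (Fin (n - 1))) :
    Equiv.Perm.sign (sortedPerm J) = (-1) ^ J.card := by
  induction J using Finset.induction_on_max with
  | empty => simp [sortedPerm_empty]
  | insert a J h ih =>
    rw [sortedPerm_insert_max h, Equiv.Perm.sign_mul, ih, simpleTransposition,
      Equiv.Perm.sign_swap (lo_ne_hi a), card_insert_of_notMem fun h' => lt_irrefl _ (h a h'), pow_succ']

/-- In an immanant of an upper Hessenberg matrix only the permutations `sortedPerm J` contribute. -/
theorem immanant_of_hessenberg {A : Type*} [CommRing A] [Algebra ℂ A]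
    (f : Equiv.Perm (Fin n) → ℂ) (M : Matrix (Fin n) (Fin n) A)
    (hM : ∀ i j : Fin n, (j : ℕ) + 1 < i → M i j = 0) :
    immanant f M = ∑ J, f (sortedPerm J) • ∏ v, M v (sortedPerm J v) := by
  rw [immanant, ← sum_subset (subset_univ (univ.image (sortedPerm (n := n)))),
    sum_image sortedPerm_injective.injOn]
  intro w _ hw
  obtain ⟨i, hi'⟩ : ∃ i, ¬ lo i ≤ w (hi i) := by
    by_contra! hc
    obtain ⟨J, rfl⟩ := exists_sortedPerm hc
    exact hw (mem_image_of_mem _ (mem_univ _))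
  rw [prod_eq_zero (mem_univ (hi i)), smul_zero]
  refine hM _ _ ?_
  simp only [lo, hi, Fin.le_def] at *; omega

theorem det_eq_immanant {A : Type*} [CommRing A] [Algebra ℂ A] (M : Matrix (Fin n) (Fin n) A) :
    M.det = immanant (fun w => ((Equiv.Perm.sign w : ℤ) : ℂ)) M := by
  -- `Matrix.det_apply` multiplies the entries M (w i) i, while an immanant multiplies M i (w i).
  rw [← Matrix.det_transpose, Matrix.det_apply, immanant]
  refine sum_congr rfl fun w _ => ?_
  rw [Units.smul_def, Int.cast_smul_eq_zsmul]
  rfl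

end SortedProducts

/-! ### Temperley–Lieb coefficients of the surviving permutations -/

section Coefficients

variable {n : ℕ}

/-- The index of an endpoint of a Kauffman diagram. -/
def endpointIndex : Fin n ⊕ Fin n → Fin n := Sum.elim id id

/-- The first clause says that strands beyond all generators used so far are still straight; it
makes the next, larger generator act without a loop. The second recovers I from the diagram: i ∈ I
exactly when the right endpoint of index i is joined to an endpoint of larger index. Multiplying by
the generator a joins the right endpoints a and a + 1, and the former partner of the right endpoint
a to the left endpoint a + 1, so this criterion is preserved. -/
theorem tau_partner (I : Finset (Fin (n - 1))) :
    (∀ j : Fin n, (∀ i ∈ I, hi i < j) → (tau I).partner (Sum.inr j) = Sum.inl j) ∧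
    ∀ i, i ∈ I ↔ lo i < endpointIndex ((tau I).partner (Sum.inr (lo i))) := by
  induction I using Finset.induction_on_max with
  | empty => simp [tau_empty, KauffmanDiagram.one, endpointIndex]
  | insert a I h ih =>
    obtain ⟨ih1, ih2⟩ := ih
    rw [tau_insert_max h]
    generalize tau I = D at *
    have hha : D.partner (Sum.inr (hi a)) = Sum.inl (hi a) := ih1 _ fun i hi' => by
      have := h i hi'; simp only [hi, Fin.lt_def] at *; omega
    have hpp := D.partner_partner
    refine ⟨fun j hj => ?_, fun i => ?_⟩
    · have hja := hj a (mem_insert_self _ _)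
      have h1 : D.partner (Sum.inr j) = Sum.inl j := ih1 j fun i hi' => hj i (mem_insert_of_mem hi')
      rw [KauffmanDiagram.mulGen_apply, if_neg, if_neg, if_neg, if_neg, h1]
      · rw [hha]; simp
      · intro hc; rw [hc, hpp] at h1; simp at h1
      · rintro ⟨⟩; exact lt_irrefl _ hja
      · rintro ⟨⟩; simp [lo, hi, Fin.lt_def] at hja
    · rw [KauffmanDiagram.mulGen_apply, mem_insert, hha]
      rcases eq_or_ne i a with rfl | hia
      · simp [endpointIndex, lo, hi]
      · have hl : lo i ≠ lo a := by simpa [lo, Fin.ext_iff] using hia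
        rw [if_neg (by simpa using hl), if_neg (c := Sum.inr (lo i) = Sum.inl (hi a)) (by simp)]
        simp only [hia, false_or]
        by_cases c1 : lo i = hi a
        · rw [if_pos (by rw [c1])]
          have : i ∉ I := fun hi' => by
            have := h i hi'; simp only [lo, hi, Fin.ext_iff, Fin.lt_def] at *; omega
          simp only [this, false_iff, endpointIndex, Sum.elim_inr, id]
          intro hlt; simp only [lo, hi, Fin.lt_def, Fin.ext_iff] at c1 hlt; omega
        · rw [if_neg (by simpa using c1)]
          split_ifs with c2
          · rw [ih2 i, c2, hpp]
            simp only [endpointIndex, Sum.elim_inr, Sum.elim_inl, id, lo, hi, Fin.lt_def, Fin.ext_iff,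
              ne_eq] at *
            omega
          · exact ih2 i

theorem tau_injective : Function.Injective (tau (n := n)) := fun I K h => by
  ext i; rw [(tau_partner I).2, (tau_partner K).2, h]

theorem TL.expand_mul_t_sub_one {ξ : ℂ} (x : TL ξ n) (a : Fin (n - 1)) :
    (x * (TL.t ξ n a - 1)).expand = actGen ξ a x.expand - x.expand := by
  simp [TL.expand, mul_sub, TL.rightAction_t]

/-- Expand ∏ (t_j - 1) one factor at a time: for the largest index a, the term -1 yields the subsets
without a and the term t_a those containing a. -/
theorem expand_theta_sortedPerm (J : Finset (Fin (n - 1))) :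
    (theta n (MonoidAlgebra.of ℂ _ (MulOpposite.op (sortedPerm J)))).expand =
      ∑ I ∈ J.powerset, Finsupp.single (tau I) ((-1) ^ (J \ I).card) := by
  induction J using Finset.induction_on_max with
  | empty =>
    simp only [sortedPerm_empty, MulOpposite.op_one, map_one]
    simp [TL.expand, tau_empty]
  | insert a J h ih =>
    have ha : a ∉ J := fun h' => lt_irrefl _ (h a h')
    rw [sortedPerm_insert_max h, MulOpposite.op_mul, map_mul, map_mul, theta_simpleTransposition,
      TL.expand_mul_t_sub_one, ih, sum_powerset_insert ha, map_sum, sub_eq_neg_add,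
      ← sum_neg_distrib]
    congr 1 <;> refine sum_congr rfl fun I hI => ?_ <;> rw [mem_powerset] at hI <;>
      have haI : a ∉ I := fun h' => ha (hI h')
    · rw [← Finsupp.single_neg, insert_sdiff_of_notMem _ haI,
        card_insert_of_notMem (by simp [ha]), pow_succ, mul_neg_one]
    · have hmax : ∀ i ∈ I, i < a := fun i hi' => h i (hI hi')
      rw [actGen_single, tau_insert_max hmax]
      congr 1
      have h1 : (tau I).partner (Sum.inr (hi a)) = Sum.inl (hi a) :=
        (tau_partner I).1 _ fun i hi' => by
          have := hmax i hi'; simp only [hi, Fin.lt_def] at *; omega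
      -- The strand at `hi a` is still straight, so no loop closes.
      have h2 : (tau I).partner (Sum.inr (lo a)) ≠ Sum.inr (hi a) := fun hc => by
        have := (tau I).partner_partner (Sum.inr (lo a))
        rw [hc, h1] at this; cases this
      rw [KauffmanDiagram.loopFactor, if_neg h2, mul_one]
      congr 2
      ext i; simp only [mem_sdiff, mem_insert]; grind

theorem tlCoeff_tau_sortedPerm (I J : Finset (Fin (n - 1))) :
    tlCoeff (tau I) (sortedPerm J) = if I ⊆ J then (-1) ^ (J \ I).card else 0 := by
  classical
  rw [tlCoeff, expand_theta_sortedPerm, Finsupp.finsetSum_apply]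
  simp only [Finsupp.single_apply, tau_injective.eq_iff, sum_ite_eq', mem_powerset]

theorem tlCoeff_sortedPerm_eq_zero {τ : KauffmanDiagram n} {J : Finset (Fin (n - 1))}
    (h : ∀ I ⊆ J, τ ≠ tau I) : tlCoeff τ (sortedPerm J) = 0 := by
  rw [tlCoeff, expand_theta_sortedPerm, Finsupp.finsetSum_apply]
  refine sum_eq_zero fun I hI => Finsupp.single_eq_of_ne ?_
  exact h I (mem_powerset.1 hI)

end Coefficients

namespace SkewShape

/-! ### Row lengths and labels of skew shapes -/

section Rows

variable (R : SkewShape)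

theorem mem_cells_iff {i j : ℕ} :
    (i, j) ∈ R.cells ↔ R.inner.rowLen i ≤ j ∧ j < R.outer.rowLen i := by
  rw [cells, mem_sdiff, YoungDiagram.mem_cells, YoungDiagram.mem_cells,
    YoungDiagram.mem_iff_lt_rowLen, YoungDiagram.mem_iff_lt_rowLen, not_lt, and_comm]

theorem lt_length_iff {i : ℕ} : i < R.length ↔ 0 < R.outer.rowLen i := by
  rw [length, ← YoungDiagram.mem_iff_lt_colLen, YoungDiagram.mem_iff_lt_rowLen]

theorem outer_rowLen_eq_zero {i : ℕ} (h : R.length ≤ i) : R.outer.rowLen i = 0 := by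
  have := R.lt_length_iff (i := i); omega

theorem inner_rowLen_le (i : ℕ) : R.inner.rowLen i ≤ R.outer.rowLen i := by
  by_contra! h
  have h1 := YoungDiagram.cells_subset_iff.2 R.le
    ((YoungDiagram.mem_cells _).2 (YoungDiagram.mem_iff_lt_rowLen.2 h))
  rw [YoungDiagram.mem_cells, YoungDiagram.mem_iff_lt_rowLen] at h1
  exact lt_irrefl _ h1

/-- The number of cells in the first `i` rows. -/
def rowSum (i : ℕ) : ℕ := ∑ j ∈ range i, (R.outer.rowLen j - R.inner.rowLen j)

theorem rowSum_succ (i : ℕ) :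
    R.rowSum (i + 1) = R.rowSum i + (R.outer.rowLen i - R.inner.rowLen i) :=
  sum_range_succ _ _

theorem card_filter_row {i c : ℕ} (hc : R.inner.rowLen i ≤ c) :
    (R.cells.filter fun d => d.1 = i ∧ c ≤ d.2).card = R.outer.rowLen i - c := by
  have : (R.cells.filter fun d => d.1 = i ∧ c ≤ d.2) = {i} ×ˢ Ico c (R.outer.rowLen i) := by
    ext ⟨a, b⟩
    simp only [mem_filter, mem_cells_iff, mem_product, mem_singleton, mem_Ico]
    constructor
    · rintro ⟨h1, rfl, h2⟩; exact ⟨rfl, h2, h1.2⟩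
    · rintro ⟨rfl, h1, h2⟩; exact ⟨⟨hc.trans h1, h2⟩, rfl, h1⟩
  rw [this, card_product, card_singleton, Nat.card_Ico, one_mul]

theorem card_filter_rows_lt (i : ℕ) : (R.cells.filter fun d => d.1 < i).card = R.rowSum i := by
  induction i with
  | zero => simp [rowSum]
  | succ i ih =>
    rw [rowSum_succ, ← ih, ← R.card_filter_row le_rfl, ← card_union_of_disjoint, ← filter_or]
    · congr 1
      refine filter_congr fun ⟨a, b⟩ h => ?_
      rw [mem_cells_iff] at h
      constructor
      · intro h'
        rcases Nat.lt_succ_iff_lt_or_eq.1 h' with h' | rfl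
        · exact Or.inl h'
        · exact Or.inr ⟨rfl, h.1⟩
      · rintro (h' | h')
        · exact h'.trans (Nat.lt_succ_self i)
        · exact h'.1 ▸ Nat.lt_succ_self _
    · refine disjoint_filter.2 fun d _ h h' => ?_
      omega

theorem label_eq {i c : ℕ} (hc : R.inner.rowLen i ≤ c) :
    R.label (i, c) = R.rowSum i + (R.outer.rowLen i - c) := by
  rw [label, filter_or, card_union_of_disjoint, card_filter_rows_lt, card_filter_row R hc]
  exact disjoint_filter.2 fun d _ h h' => h.ne h'.1

theorem rowSum_length : R.rowSum R.length = R.size := by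
  rw [← card_filter_rows_lt, size, filter_true_of_mem]
  rintro ⟨i, j⟩ h
  rw [mem_cells_iff] at h
  exact R.lt_length_iff.2 ((Nat.zero_le j).trans_lt h.2)

end Rows

/-! ### Row overlaps, descents and Jacobi–Trudi indices of ribbons -/

section Ribbons

variable {m : ℕ} {R : SkewShape}

theorem exists_vertical_step {R : SkewShape} {i : ℕ} {a b : ℕ × ℕ} (ha : a ∈ R.cells) (hai : a.1 ≤ i)
    (hbi : i < b.1)
    (hab : Relation.ReflTransGen (fun c d => d ∈ R.cells ∧ Adjacent c d) a b) :
    ∃ c, (i, c) ∈ R.cells ∧ (i + 1, c) ∈ R.cells := by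
  have : ∀ b, Relation.ReflTransGen (fun c d => d ∈ R.cells ∧ Adjacent c d) a b →
      b ∈ R.cells ∧ (b.1 ≤ i ∨ ∃ c, (i, c) ∈ R.cells ∧ (i + 1, c) ∈ R.cells) := by
    intro b hb
    induction hb with
    | refl => exact ⟨ha, Or.inl hai⟩
    | @tail b c _ hbc ih =>
      obtain ⟨hb, ih⟩ := ih
      obtain ⟨hc, hadj⟩ := hbc
      refine ⟨hc, ?_⟩
      rcases ih with ih | ih
      · by_cases hci : c.1 ≤ i
        · exact Or.inl hci
        · obtain ⟨b1, b2⟩ := b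
          obtain ⟨c1, c2⟩ := c
          simp only [Adjacent] at *
          obtain rfl : b1 = i := by omega
          obtain rfl : c1 = b1 + 1 := by omega
          obtain rfl : b2 = c2 := by omega
          exact Or.inr ⟨b2, hb, hc⟩
      · exact Or.inr ih
  rcases (this b hab).2 with h | h
  · omega
  · exact h

theorem inner_lt_outer (hR : R ∈ ribbons m) {i : ℕ} (h : i < R.length) :
    R.inner.rowLen i < R.outer.rowLen i := (hR.2.2 i).2 h

/-- Connectedness forces a vertical step between the two rows, so they share at least one column;
two shared columns would give a 2 × 2 block. -/
theorem outer_rowLen_succ (hR : R ∈ ribbons m) {i : ℕ} (h : i + 1 < R.length) :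
    R.outer.rowLen (i + 1) = R.inner.rowLen i + 1 := by
  obtain ⟨⟨hconn, hsq⟩, -, -⟩ := id hR
  have h1 := inner_lt_outer hR h
  have h2 := inner_lt_outer hR (show i < R.length by omega)
  have h3 := R.outer.rowLen_anti i (i + 1) (by omega)
  have h4 := R.inner.rowLen_anti i (i + 1) (by omega)
  have ha : (i, R.inner.rowLen i) ∈ R.cells := R.mem_cells_iff.2 ⟨le_rfl, h2⟩
  have hb : (i + 1, R.inner.rowLen (i + 1)) ∈ R.cells := R.mem_cells_iff.2 ⟨le_rfl, h1⟩
  obtain ⟨c, hc1, hc2⟩ := exists_vertical_step (i := i) ha le_rfl (Nat.lt_succ_self i) (hconn _ ha _ hb)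
  rw [mem_cells_iff] at hc1 hc2
  by_contra hne
  refine hsq i (R.inner.rowLen i) ?_
  simp only [mem_cells_iff]
  omega

theorem rowSum_length_eq (hR : R ∈ ribbons m) : R.rowSum R.length = m := by
  rw [rowSum_length, hR.2.1]

theorem rowSum_lt_rowSum (hR : R ∈ ribbons m) {i j : ℕ} (hij : i < j) (hj : j ≤ R.length) :
    R.rowSum i < R.rowSum j := by
  induction j, hij using Nat.le_induction with
  | base => rw [rowSum_succ]; have := inner_lt_outer hR hj; omega
  | succ j hij ih => rw [rowSum_succ]; have := ih (by omega); omega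

theorem rowSum_lt_rowSum_iff (hR : R ∈ ribbons m) {i j : ℕ} (hi : i ≤ R.length)
    (hj : j ≤ R.length) : R.rowSum i < R.rowSum j ↔ i < j := by
  refine ⟨fun h => ?_, fun h => rowSum_lt_rowSum hR h hj⟩
  by_contra! hc
  rcases hc.eq_or_lt with rfl | hc
  · exact lt_irrefl _ h
  · exact lt_asymm h (rowSum_lt_rowSum hR hc hi)

theorem rowSum_injOn (hR : R ∈ ribbons m) : Set.InjOn R.rowSum (Set.Iic R.length) := by
  intro i hi j hj h
  have h1 := rowSum_lt_rowSum_iff hR hi hj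
  have h2 := rowSum_lt_rowSum_iff hR hj hi
  omega

/-- A cell has another one directly below it only if it is the leftmost of its row, and its label is
then the number of cells up to the end of that row. -/
theorem Des_eq (hR : R ∈ ribbons m) : R.Des = d (Set.Icc 1 (R.length - 1)) R := by
  ext x
  constructor
  · rintro ⟨r, c, h1, h2, h3, -⟩
    rw [mem_cells_iff] at h1 h2
    have hr : r + 1 < R.length := R.lt_length_iff.2 (by omega)
    have h4 := outer_rowLen_succ hR hr
    obtain rfl : c = R.inner.rowLen r := by omega
    rw [label_eq R le_rfl, ← rowSum_succ] at h3
    exact ⟨r + 1, ⟨by omega, by omega⟩, h3⟩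
  · rintro ⟨i, ⟨h1, h2⟩, rfl⟩
    obtain ⟨r, rfl⟩ : ∃ r, i = r + 1 := ⟨i - 1, by omega⟩
    have hr : r + 1 < R.length := by omega
    have h4 := outer_rowLen_succ hR hr
    have h5 := inner_lt_outer hR hr
    have h6 := inner_lt_outer hR (show r < R.length by omega)
    refine ⟨r, R.inner.rowLen r, ?_, ?_, ?_, ?_⟩
    · rw [mem_cells_iff]; omega
    · rw [mem_cells_iff]; omega
    · rw [label_eq R le_rfl, ← rowSum_succ]; rfl
    · rw [label_eq R (by omega)]
      change R.rowSum (r + 1) + _ = R.rowSum (r + 1) + 1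
      omega

/-- The index of the entry `(v, b)` of the Jacobi--Trudi matrix of a ribbon. -/
theorem jacobiTrudi_index (hR : R ∈ ribbons m) {v b : ℕ} (hvb : v ≤ b) (hb : b < R.length) :
    (R.outer.rowLen v : ℤ) - R.inner.rowLen b - v + b = R.rowSum (b + 1) - R.rowSum v := by
  induction b, hvb using Nat.le_induction with
  | base =>
    have := inner_lt_outer hR hb
    rw [rowSum_succ]; omega
  | succ b hvb ih =>
    have h1 := ih (by omega)
    have h2 := outer_rowLen_succ hR hb
    have h3 := inner_lt_outer hR hb
    rw [rowSum_succ]; omega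

theorem jacobiTrudi_index_neg (hR : R ∈ ribbons m) {i j : ℕ} (hij : j + 1 < i) :
    (R.outer.rowLen i : ℤ) - R.inner.rowLen j - i + j < 0 := by
  have h1 := R.outer.rowLen_anti (j + 1) i (by omega)
  by_cases h : j + 1 < R.length
  · have := outer_rowLen_succ hR h; omega
  · have := R.outer_rowLen_eq_zero (not_lt.1 h); omega

end Ribbons

/-! ### Existence of a ribbon with prescribed descents -/

section Existence

/-- The row of the cell labelled `p + 1` in a ribbon with descent set `D`. -/
def ribbonRow (D : Finset ℕ) (p : ℕ) : ℕ := ((range p).filter fun q => q + 1 ∈ D).card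

theorem ribbonRow_succ (D : Finset ℕ) (p : ℕ) :
    ribbonRow D (p + 1) = ribbonRow D p + if p + 1 ∈ D then 1 else 0 := by
  rw [ribbonRow, range_add_one, filter_insert]
  split_ifs
  · rw [card_insert_of_notMem (by simp)]; rfl
  · rfl

theorem ribbonRow_mono {D : Finset ℕ} {p q : ℕ} (h : p ≤ q) :
    ribbonRow D p ≤ ribbonRow D q ∧ ribbonRow D q ≤ ribbonRow D p + (q - p) := by
  induction q, h using Nat.le_induction with
  | base => simp
  | succ q h ih => rw [ribbonRow_succ]; split_ifs <;> omega

theorem ribbonRow_zero (D : Finset ℕ) : ribbonRow D 0 = 0 := by simp [ribbonRow]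

/-- The column of the cell labelled `p + 1` in a ribbon of size `m` with descent set `D`. -/
def ribbonCol (D : Finset ℕ) (m p : ℕ) : ℕ := (m - 1 - ribbonRow D (m - 1)) - (p - ribbonRow D p)

/-- This is the truncation-free form of: column minus row equals a constant minus p. Each cell
therefore lies on a diagonal of its own, which gives injectivity of the labelling and excludes 2 × 2
blocks. -/
theorem ribbonCol_add {D : Finset ℕ} {m p : ℕ} (h : p < m) :
    ribbonCol D m p + p + ribbonRow D (m - 1) = m - 1 + ribbonRow D p := by
  have h1 := ribbonRow_mono (D := D) (show p ≤ m - 1 by omega)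
  have h2 := ribbonRow_mono (D := D) (Nat.zero_le p)
  have h3 := ribbonRow_mono (D := D) (Nat.zero_le (m - 1))
  rw [ribbonRow_zero] at h2 h3
  rw [ribbonCol]
  omega

/-- The ribbon of size `m` with descent set `D`: the skew shape whose cells are the
`(ribbonRow D p, ribbonCol D m p)`, `p < m`. -/
def ofDescents (D : Finset ℕ) (m : ℕ) : SkewShape where
  outer :=
    { cells := (range m).biUnion fun p => Iic (ribbonRow D p) ×ˢ Iic (ribbonCol D m p)
      isLowerSet := by
        rintro ⟨a, b⟩ ⟨a', b'⟩ ⟨h1, h2⟩ h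
        simp only [coe_biUnion, Set.mem_iUnion, mem_coe, mem_product, mem_Iic] at *
        obtain ⟨p, hp, h3, h4⟩ := h
        exact ⟨p, hp, h1.trans h3, h2.trans h4⟩ }
  inner :=
    { cells := (range m).biUnion fun p => Iio (ribbonRow D p) ×ˢ Iio (ribbonCol D m p)
      isLowerSet := by
        rintro ⟨a, b⟩ ⟨a', b'⟩ ⟨h1, h2⟩ h
        simp only [coe_biUnion, Set.mem_iUnion, mem_coe, mem_product, mem_Iio] at *
        obtain ⟨p, hp, h3, h4⟩ := h
        exact ⟨p, hp, h1.trans_lt h3, h2.trans_lt h4⟩ }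
  le := by
    rw [← YoungDiagram.cells_subset_iff]
    exact biUnion_mono fun p _ => product_subset_product Iio_subset_Iic_self Iio_subset_Iic_self

variable {D : Finset ℕ} {m : ℕ}

theorem mem_outer_ofDescents {i j : ℕ} :
    (i, j) ∈ (ofDescents D m).outer.cells ↔ ∃ p < m, i ≤ ribbonRow D p ∧ j ≤ ribbonCol D m p := by
  simp [ofDescents]

theorem cells_ofDescents : (ofDescents D m).cells =
    (range m).image fun p => (ribbonRow D p, ribbonCol D m p) := by
  ext ⟨i, j⟩
  simp only [cells, ofDescents, mem_sdiff, mem_biUnion, mem_range, mem_product, mem_Iic, mem_Iio,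
    mem_image, Prod.mk.injEq, not_exists, not_and]
  constructor
  · rintro ⟨⟨p, hp, h1, h2⟩, h3⟩
    have e1 := ribbonCol_add (D := D) hp
    have m1 := ribbonRow_mono (D := D) (Nat.zero_le p)
    have m2 := ribbonRow_mono (D := D) (show p ≤ m - 1 by omega)
    rw [ribbonRow_zero] at m1
    -- The index q is that of the ribbon cell on the diagonal of (i, j). If (i, j) were not this
    -- cell, it would lie strictly above and left of it, contradicting `h3`, or strictly below and
    -- right of it. In the latter case cell q would lie strictly above and left of cell p,
    -- contradicting `h5`.
    obtain ⟨q, hq⟩ : ∃ q, j + q + ribbonRow D (m - 1) = m - 1 + i :=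
      ⟨m - 1 + i - j - ribbonRow D (m - 1), by omega⟩
    have hqm : q < m := by omega
    have e2 := ribbonCol_add (D := D) hqm
    have h4 := h3 q hqm
    have h5 : ¬ (ribbonRow D q < ribbonRow D p ∧ ribbonCol D m q < ribbonCol D m p) := by
      rcases le_total p q with h | h
      · have := ribbonRow_mono (D := D) h; omega
      · have := ribbonRow_mono (D := D) h; omega
    exact ⟨q, hqm, by omega, by omega⟩
  · rintro ⟨p, hp, rfl, rfl⟩
    refine ⟨⟨p, hp, le_rfl, le_rfl⟩, fun q hq h1 h2 => ?_⟩
    have e1 := ribbonCol_add (D := D) hp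
    have e2 := ribbonCol_add (D := D) hq
    rcases le_total p q with h | h
    · have := ribbonRow_mono (D := D) h; omega
    · have := ribbonRow_mono (D := D) h; omega

theorem mem_cells_ofDescents {c : ℕ × ℕ} : c ∈ (ofDescents D m).cells ↔
    ∃ p < m, (ribbonRow D p, ribbonCol D m p) = c := by
  simp [cells_ofDescents]

theorem adjacent_ofDescents {p : ℕ} (hp : p + 1 < m) :
    Adjacent (ribbonRow D p, ribbonCol D m p) (ribbonRow D (p + 1), ribbonCol D m (p + 1)) := by
  have e1 := ribbonCol_add (D := D) hp
  have e2 := ribbonCol_add (D := D) (show p < m by omega)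
  rw [ribbonRow_succ] at *
  simp only [Adjacent]
  split_ifs at * <;> omega

theorem injOn_ofDescents :
    Set.InjOn (fun p => (ribbonRow D p, ribbonCol D m p)) (range m : Set ℕ) := by
  intro p hp q hq h
  simp only [Prod.mk.injEq, coe_range, Set.mem_Iio] at *
  have e1 := ribbonCol_add (D := D) hp
  have e2 := ribbonCol_add (D := D) hq
  omega

theorem label_ofDescents {p : ℕ} (hp : p < m) :
    (ofDescents D m).label (ribbonRow D p, ribbonCol D m p) = p + 1 := by
  rw [label, cells_ofDescents, filter_image, card_image_of_injOn
    (injOn_ofDescents.mono (by exact_mod_cast filter_subset _ _))]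
  rw [show ((range m).filter fun q => ribbonRow D q < ribbonRow D p ∨
      (ribbonRow D q = ribbonRow D p ∧ ribbonCol D m p ≤ ribbonCol D m q)) = range (p + 1) from ?_,
    card_range]
  ext q
  simp only [mem_filter, mem_range]
  constructor
  · rintro ⟨hq, h⟩
    have e1 := ribbonCol_add (D := D) hp
    have e2 := ribbonCol_add (D := D) hq
    by_contra hc
    have := ribbonRow_mono (D := D) (show p ≤ q by omega)
    omega
  · intro h
    have e1 := ribbonCol_add (D := D) hp
    have e2 := ribbonCol_add (D := D) (show q < m by omega)
    have := ribbonRow_mono (D := D) (show q ≤ p by omega)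
    omega

theorem ofDescents_mem_ribbons : ofDescents D m ∈ ribbons m := by
  refine ⟨⟨?_, ?_⟩, ?_, fun i => ⟨fun h => ?_, fun h => ?_⟩⟩
  · intro a ha b hb
    obtain ⟨p, hp, rfl⟩ := mem_cells_ofDescents.1 ha
    obtain ⟨q, hq, rfl⟩ := mem_cells_ofDescents.1 hb
    clear ha hb
    rcases le_total p q with h | h
    · induction q, h using Nat.le_induction with
      | base => exact .refl
      | succ q h ih =>
        exact (ih (by omega)).tail ⟨mem_cells_ofDescents.2 ⟨q + 1, hq, rfl⟩, adjacent_ofDescents hq⟩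
    · induction p, h using Nat.le_induction with
      | base => exact .refl
      | succ p h ih =>
        refine .head ⟨mem_cells_ofDescents.2 ⟨p, by omega, rfl⟩, ?_⟩ (ih (by omega))
        have := adjacent_ofDescents (D := D) hp
        simp only [Adjacent] at *
        omega
  · rintro i j ⟨h1, -, -, h2⟩
    obtain ⟨p, hp, h1⟩ := mem_cells_ofDescents.1 h1
    obtain ⟨q, hq, h2⟩ := mem_cells_ofDescents.1 h2
    simp only [Prod.mk.injEq] at h1 h2
    have e1 := ribbonCol_add (D := D) hp
    have e2 := ribbonCol_add (D := D) hq
    rcases le_total p q with h | h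
    · have := ribbonRow_mono (D := D) h; omega
    · have := ribbonRow_mono (D := D) h; omega
  · rw [size, cells_ofDescents, card_image_of_injOn injOn_ofDescents, card_range]
  · exact (lt_length_iff _).2 (by omega)
  · rw [length, ← YoungDiagram.mem_iff_lt_colLen, ← YoungDiagram.mem_cells,
      mem_outer_ofDescents] at h
    obtain ⟨p, hp, h, -⟩ := h
    -- Rows start at 0 and grow by at most one per step, so none is skipped.
    obtain ⟨q, hq, rfl⟩ : ∃ q ≤ p, ribbonRow D q = i := by
      clear hp
      induction p with
      | zero => exact ⟨0, le_rfl, by rw [ribbonRow_zero] at *; omega⟩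
      | succ p ih =>
        by_cases hpi : i ≤ ribbonRow D p
        · obtain ⟨q, hq, h⟩ := ih hpi
          exact ⟨q, by omega, h⟩
        · refine ⟨p + 1, le_rfl, ?_⟩
          rw [ribbonRow_succ] at *
          split_ifs at * <;> omega
    have := (mem_cells_iff _).1 (mem_cells_ofDescents (D := D).2 ⟨q, hq.trans_lt hp, rfl⟩)
    exact this.1.trans_lt this.2

theorem Des_ofDescents (hD : ∀ x ∈ D, 1 ≤ x ∧ x < m) : (ofDescents D m).Des = D := by
  ext x
  constructor
  · rintro ⟨r, c, h1, h2, h3, h4⟩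
    obtain ⟨p, hp, h1⟩ := mem_cells_ofDescents.1 h1
    obtain ⟨q, hq, h2⟩ := mem_cells_ofDescents.1 h2
    rw [← h1, label_ofDescents hp] at h3
    rw [← h2, label_ofDescents hq] at h4
    obtain rfl : q = p + 1 := by omega
    rw [ribbonRow_succ] at h2
    simp only [Prod.mk.injEq] at h1 h2
    by_contra hx
    rw [← h3, mem_coe] at hx
    rw [if_neg hx] at h2
    omega
  · intro hx
    have := hD x hx
    obtain ⟨p, rfl⟩ : ∃ p, x = p + 1 := ⟨x - 1, by omega⟩
    have e1 := ribbonCol_add (D := D) this.2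
    have e2 := ribbonCol_add (D := D) (show p < m by omega)
    have h : (ribbonRow D p + 1, ribbonCol D m p) =
        (ribbonRow D (p + 1), ribbonCol D m (p + 1)) := by
      rw [ribbonRow_succ, if_pos (mem_coe.1 hx)] at *
      rw [Prod.mk.injEq]; omega
    refine ⟨ribbonRow D p, ribbonCol D m p, mem_cells_ofDescents.2 ⟨p, by omega, rfl⟩, ?_,
      label_ofDescents (by omega), ?_⟩
    · rw [h]; exact mem_cells_ofDescents.2 ⟨_, this.2, rfl⟩
    · rw [h, label_ofDescents this.2]

end Existence

end SkewShape

/-! ### Immanants as alternating sums of block products -/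

section BlockProducts

variable {A : Type*} [CommRing A]

/-- The smallest element of `T` that is larger than `c`. -/
noncomputable def nextIn (T : Finset ℕ) (c : ℕ) : ℕ := sInf {t | t ∈ T ∧ c < t}

theorem nextIn_eq {T : Finset ℕ} {c t : ℕ} (ht : t ∈ T) (hct : c < t)
    (hmin : ∀ u ∈ T, c < u → t ≤ u) : nextIn T c = t :=
  le_antisymm (Nat.sInf_le ⟨ht, hct⟩) (le_csInf ⟨t, ht, hct⟩ fun u hu => hmin u hu.1 hu.2)

/-- The product of the values of `E` at the lengths of the blocks into which the points of `D` cut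
the interval from `0` to `m`. -/
noncomputable def blockProd (E : ℤ → A) (m : ℕ) (D : Finset ℕ) : A :=
  ∏ c ∈ insert 0 D, E (nextIn (insert m D) c - c)

variable {m n : ℕ} {R : SkewShape}

open SkewShape

/-- The matrix `(E (λ_i - μ_j - i + j))_{i,j}`. -/
def shapeMatrix (n : ℕ) (R : SkewShape) (E : ℤ → A) : Matrix (Fin n) (Fin n) A :=
  Matrix.of fun i j =>
    E ((R.outer.rowLen i : ℤ) - (R.inner.rowLen j : ℤ) - (i : ℤ) + (j : ℤ))

/-- The indices of the pairs of consecutive nonempty rows. -/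
def innerRows (n : ℕ) (R : SkewShape) : Finset (Fin (n - 1)) :=
  univ.filter fun i => (i : ℕ) + 1 < R.length

theorem mem_innerRows {i : Fin (n - 1)} : i ∈ innerRows n R ↔ (i : ℕ) + 1 < R.length := by
  simp [innerRows]

/-- The set of numbers of cells in the first `i + 1` rows, for `i ∈ K`. -/
def rowSums (R : SkewShape) (K : Finset (Fin (n - 1))) : Finset ℕ :=
  K.image fun i : Fin (n - 1) => R.rowSum (i + 1)

theorem prod_shapeMatrix (hR : R ∈ ribbons m) (hn : R.length ≤ n) {E : ℤ → A} (h0 : E 0 = 1)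
    {J : Finset (Fin (n - 1))} (hJ : J ⊆ innerRows n R) :
    ∏ v, shapeMatrix n R E v (sortedPerm J v) =
      blockProd E m (rowSums R (innerRows n R \ J)) := by
  obtain ⟨h1, h2⟩ := sortedPerm_spec J
  have hJ' : ∀ i ∈ J, (i : ℕ) + 1 < R.length := fun i hi' => mem_innerRows.1 (hJ hi')
  -- These are the first rows of the blocks merged by J; `sortedPerm J` sends each to the last row
  -- of its block. Every other row contributes E 0 = 1: on the subdiagonal inside a block, on the
  -- diagonal past the last nonempty row.
  set starts : Finset (Fin n) := univ.filter fun v => (v : ℕ) < R.length ∧ ∀ i ∈ J, hi i ≠ v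
    with hstarts
  have hmem : ∀ v, v ∈ starts ↔ (v : ℕ) < R.length ∧ ∀ i ∈ J, hi i ≠ v := by simp [hstarts]
  rw [← prod_subset (subset_univ starts)]
  swap
  · intro v _ hv
    rw [hmem] at hv
    by_cases hvJ : ∃ i ∈ J, hi i = v
    · obtain ⟨i, hi', rfl⟩ := hvJ
      have := outer_rowLen_succ hR (hJ' i hi')
      rw [h1 i hi', shapeMatrix, Matrix.of_apply, ← h0]
      congr 1
      simp only [hi, lo, this]
      push_cast; ring
    · push Not at hvJ
      have hvl : R.length ≤ v := by
        by_contra hc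
        exact hv ⟨not_le.1 hc, hvJ⟩
      obtain ⟨h3, h4, -⟩ := h2 v hvJ
      have hfix : sortedPerm J v = v := by
        by_contra hne
        obtain ⟨i, hi', rfl⟩ := h4 v le_rfl (lt_of_le_of_ne h3 (Ne.symm hne))
        have := hJ' i hi'
        simp only [lo] at hvl; omega
      have h5 := R.outer_rowLen_eq_zero hvl
      have h6 := R.inner_rowLen_le v
      rw [hfix, shapeMatrix, Matrix.of_apply, ← h0]
      congr 1
      omega
  have hend : ∀ v ∈ starts, (sortedPerm J v : ℕ) < R.length := by
    intro v hv
    obtain ⟨hvl, hvJ⟩ := (hmem v).1 hv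
    by_contra! hc
    obtain ⟨i, hi', he⟩ := (h2 v hvJ).2.1 ⟨sortedPerm J v - 1, by omega⟩
      (by rw [Fin.le_def]; simp only; omega) (by rw [Fin.lt_def]; simp only; omega)
    have := hJ' i hi'
    simp only [lo, Fin.ext_iff] at he
    omega
  have hentry : ∀ v ∈ starts, shapeMatrix n R E v (sortedPerm J v) =
      E (R.rowSum (sortedPerm J v + 1) - R.rowSum v) := by
    intro v hv
    rw [shapeMatrix, Matrix.of_apply,
      jacobiTrudi_index hR (h2 v ((hmem v).1 hv).2).1 (hend v hv)]
  rw [prod_congr rfl hentry]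
  -- For the empty ribbon `blockProd` still has the factor at c = 0. There `nextIn` is the infimum
  -- of the empty set, which is 0 in ℕ, so the factor is E 0 = 1.
  rcases Nat.eq_zero_or_pos R.length with hl | hl
  · have hm : m = 0 := by rw [← rowSum_length_eq hR, hl]; rfl
    have hs : starts = ∅ := by ext v; simp [hmem, hl]
    have hi : innerRows n R = ∅ := by ext v; simp [mem_innerRows, hl]
    have hempty : {t : ℕ | t = 0 ∧ 0 < t} = ∅ := by ext t; simp
    simp [hs, hi, hm, rowSums, blockProd, nextIn, hempty, h0]
  have himage : insert 0 (rowSums R (innerRows n R \ J)) =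
      starts.image fun v : Fin n => R.rowSum v := by
    ext x
    simp only [rowSums, mem_insert, mem_image, mem_sdiff, mem_innerRows, hmem]
    constructor
    · rintro (rfl | ⟨i, ⟨hi1, hi2⟩, rfl⟩)
      · exact ⟨⟨0, by omega⟩, ⟨hl, fun i _ => by simp [hi]⟩, by simp [rowSum]⟩
      · refine ⟨hi i, ⟨hi1, fun j hj he => hi2 ?_⟩, rfl⟩
        rwa [show i = j by simpa [hi, Fin.ext_iff] using he.symm]
    · rintro ⟨⟨v, hvn⟩, ⟨hv1, hv2⟩, rfl⟩
      rcases v with _ | v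
      · exact Or.inl (by simp [rowSum])
      · exact Or.inr ⟨⟨v, by omega⟩, ⟨hv1, fun hc => hv2 _ hc rfl⟩, rfl⟩
  rw [blockProd, himage, prod_image]
  · refine prod_congr rfl fun v hv => ?_
    obtain ⟨hvl, hvJ⟩ := (hmem v).1 hv
    obtain ⟨h3, h4, h5⟩ := h2 v hvJ
    have hev := hend v hv
    rw [nextIn_eq (t := R.rowSum (sortedPerm J v + 1))]
    · by_cases hlast : (sortedPerm J v : ℕ) + 1 = R.length
      · rw [hlast, rowSum_length_eq hR]; exact mem_insert_self _ _
      · refine mem_insert_of_mem (mem_image.2 ⟨⟨sortedPerm J v, by omega⟩, ?_, rfl⟩)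
        rw [mem_sdiff, mem_innerRows]
        exact ⟨by simp only; omega, fun hc => h5 _ hc rfl⟩
    · rw [rowSum_lt_rowSum_iff hR hvl.le hev]
      exact Nat.lt_succ_of_le h3
    · intro u hu hvu
      rcases mem_insert.1 hu with rfl | hu
      · rw [← rowSum_length_eq hR]
        rcases (Nat.succ_le_of_lt hev).eq_or_lt with h | h
        · rw [← h]
        · exact (rowSum_lt_rowSum hR h le_rfl).le
      · obtain ⟨i, hi', rfl⟩ := mem_image.1 hu
        rw [mem_sdiff, mem_innerRows] at hi'
        rw [rowSum_lt_rowSum_iff hR hvl.le hi'.1.le] at hvu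
        by_contra hc
        rw [not_le, rowSum_lt_rowSum_iff hR hi'.1.le hev] at hc
        -- A cut before the end of the block would come after a row i with v ≤ i below the last row
        -- of the block, but all such i belong to J.
        obtain ⟨j, hj, he⟩ := h4 (lo i) (by simp only [lo, Fin.le_def]; omega)
          (by simp only [lo, Fin.lt_def]; omega)
        refine hi'.2 ?_
        rwa [show i = j by simpa [lo, Fin.ext_iff] using he.symm]
  · intro v hv w hw h
    exact Fin.ext (rowSum_injOn hR ((hmem v).1 hv).1.le ((hmem w).1 hw).1.le h)

theorem prod_shapeMatrix_eq_zero {E : ℤ → A} (hneg : ∀ d < 0, E d = 0)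
    {J : Finset (Fin (n - 1))} (hJ : ¬ J ⊆ innerRows n R) :
    ∏ v, shapeMatrix n R E v (sortedPerm J v) = 0 := by
  obtain ⟨i, hi', hi2⟩ := not_subset.1 hJ
  rw [mem_innerRows, not_lt] at hi2
  refine prod_eq_zero (mem_univ (hi i)) ?_
  rw [(sortedPerm_spec J).1 i hi', shapeMatrix, Matrix.of_apply]
  apply hneg
  have : R.outer.rowLen (hi i) = 0 := R.outer_rowLen_eq_zero hi2
  rw [this]; simp only [hi, lo]; omega

variable [Algebra ℂ A]

/-- The alternating sum of the block products over all coarsenings of `T`. -/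
noncomputable def coarseningSum (E : ℤ → A) (m : ℕ) (T : Finset ℕ) : A :=
  ∑ D ∈ T.powerset, ((-1 : ℂ) ^ (T \ D).card) • blockProd E m D

theorem immanant_shapeMatrix (hR : R ∈ ribbons m) (hn : R.length ≤ n) {E : ℤ → A} (h0 : E 0 = 1)
    (hneg : ∀ d < 0, E d = 0) (f : Equiv.Perm (Fin n) → ℂ) :
    immanant f (shapeMatrix n R E) = ∑ J ∈ (innerRows n R).powerset,
      f (sortedPerm J) • blockProd E m (rowSums R (innerRows n R \ J)) := by
  rw [immanant_of_hessenberg f (shapeMatrix n R E) fun i j hij => hneg _ (jacobiTrudi_index_neg hR hij),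
    ← sum_subset (subset_univ (innerRows n R).powerset)]
  · refine sum_congr rfl fun J hJ => ?_
    rw [prod_shapeMatrix hR hn h0 (mem_powerset.1 hJ)]
  · intro J _ hJ
    rw [prod_shapeMatrix_eq_zero hneg (fun h => hJ (mem_powerset.2 h)), smul_zero]

/-- The condition `hf` is shared by the coefficients of τ(I) and, for I = ∅, by the sign, so both
sides of the main identity come from here. Complementation turns the sets J ⊇ I into the sets D of
cuts contained in T, and J \ I corresponds to T \ D. -/
theorem immanant_shapeMatrix_eq_coarseningSum (hR : R ∈ ribbons m) (hn : R.length ≤ n) {E : ℤ → A}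
    (h0 : E 0 = 1) (hneg : ∀ d < 0, E d = 0) {f : Equiv.Perm (Fin n) → ℂ}
    {I : Finset (Fin (n - 1))} (hI : I ⊆ innerRows n R)
    (hf : ∀ J, f (sortedPerm J) = if I ⊆ J then (-1) ^ (J \ I).card else 0) :
    immanant f (shapeMatrix n R E) = coarseningSum E m (rowSums R (innerRows n R \ I)) := by
  have hinj : Set.InjOn (fun i : Fin (n - 1) => R.rowSum (i + 1)) (innerRows n R) := by
    intro i hi' j hj h
    have h1 := mem_innerRows.1 hi'
    have h2 := mem_innerRows.1 hj
    have := rowSum_injOn hR (Set.mem_Iic.2 h1.le) (Set.mem_Iic.2 h2.le) h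
    exact Fin.ext (by omega)
  rw [immanant_shapeMatrix hR hn h0 hneg, coarseningSum]
  simp only [hf, ite_smul, zero_smul]
  rw [← sum_filter]
  refine sum_bij' (fun J _ => rowSums R (innerRows n R \ J))
    (fun D _ => (innerRows n R).filter fun i => R.rowSum (i + 1) ∉ D) ?_ ?_ ?_ ?_ ?_
  · intro J hJ
    rw [mem_filter, mem_powerset] at hJ
    exact mem_powerset.2 (image_subset_image (sdiff_subset_sdiff le_rfl hJ.2))
  · intro D hD
    rw [mem_powerset] at hD
    rw [mem_filter, mem_powerset]
    refine ⟨filter_subset _ _, fun i hi' => mem_filter.2 ⟨hI hi', fun hc => ?_⟩⟩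
    obtain ⟨j, hj, he⟩ := mem_image.1 (hD hc)
    rw [mem_sdiff] at hj
    rw [hinj hj.1 (hI hi') he] at hj
    exact hj.2 hi'
  · intro J hJ
    rw [mem_filter, mem_powerset] at hJ
    ext i
    simp only [mem_filter, rowSums, mem_image, mem_sdiff, not_exists, not_and]
    constructor
    · rintro ⟨h1, h2⟩
      by_contra hc
      exact h2 i ⟨h1, hc⟩ rfl
    · intro h
      exact ⟨hJ.1 h, fun j hj he => hj.2 (hinj hj.1 (hJ.1 h) he ▸ h)⟩
  · intro D hD
    rw [mem_powerset] at hD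
    ext x
    simp only [rowSums, mem_image, mem_sdiff, mem_filter, not_and, not_not]
    constructor
    · rintro ⟨i, ⟨h1, h2⟩, rfl⟩
      exact h2 h1
    · intro hx
      obtain ⟨j, hj, rfl⟩ := mem_image.1 (hD hx)
      exact ⟨j, ⟨(mem_sdiff.1 hj).1, fun _ => hx⟩, rfl⟩
  · intro J hJ
    rw [mem_filter, mem_powerset] at hJ
    congr 2
    rw [rowSums, rowSums, ← image_sdiff_of_injOn (hinj.mono (coe_subset.2 sdiff_subset))
      (sdiff_subset_sdiff le_rfl hJ.2),
      card_image_of_injOn (hinj.mono (coe_subset.2 (sdiff_subset.trans sdiff_subset)))]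
    congr 1
    ext i
    have := @hJ.1 i
    simp only [mem_sdiff]; tauto

theorem det_shapeMatrix (hR : R ∈ ribbons m) (hn : R.length ≤ n) {E : ℤ → A}
    (h0 : E 0 = 1) (hneg : ∀ d < 0, E d = 0) :
    (shapeMatrix n R E).det = coarseningSum E m (rowSums R (innerRows n R)) := by
  rw [det_eq_immanant, immanant_shapeMatrix_eq_coarseningSum hR hn h0 hneg (empty_subset _),
    sdiff_empty]
  intro J
  simp [sign_sortedPerm]

theorem tlImmanant_tau_shapeMatrix (hR : R ∈ ribbons m) (hn : R.length ≤ n) {E : ℤ → A}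
    (h0 : E 0 = 1) (hneg : ∀ d < 0, E d = 0) {I : Finset (Fin (n - 1))} (hI : I ⊆ innerRows n R) :
    tlImmanant (tau I) (shapeMatrix n R E) = coarseningSum E m (rowSums R (innerRows n R \ I)) :=
  immanant_shapeMatrix_eq_coarseningSum hR hn h0 hneg hI (tlCoeff_tau_sortedPerm I)

theorem tlImmanant_shapeMatrix_eq_zero (hR : R ∈ ribbons m) (hn : R.length ≤ n) {E : ℤ → A}
    (h0 : E 0 = 1) (hneg : ∀ d < 0, E d = 0) {τ : KauffmanDiagram n}
    (hτ : ∀ I ⊆ innerRows n R, τ ≠ tau I) : tlImmanant τ (shapeMatrix n R E) = 0 := by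
  rw [tlImmanant, immanant_shapeMatrix hR hn h0 hneg]
  refine sum_eq_zero fun J hJ => ?_
  rw [tlCoeff_sortedPerm_eq_zero fun I hI => hτ I (hI.trans (mem_powerset.1 hJ)), zero_smul]

theorem coe_rowSums (hn : R.length ≤ n) (I : Finset (Fin (n - 1))) :
    (rowSums R (innerRows n R \ I) : Set ℕ) =
      d (Set.Icc 1 (R.length - 1) \ {j | ∃ i ∈ I, j = (i : ℕ) + 1}) R := by
  ext x
  simp only [rowSums, coe_image, Set.mem_image, mem_coe, mem_sdiff, mem_innerRows, d]
  constructor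
  · rintro ⟨i, ⟨h1, h2⟩, rfl⟩
    refine ⟨i + 1, ⟨⟨by omega, by omega⟩, ?_⟩, rfl⟩
    rintro ⟨j, hj, he⟩
    rw [show i = j from Fin.ext (by omega)] at h2
    exact h2 hj
  · rintro ⟨j, ⟨⟨h1, h2⟩, h3⟩, rfl⟩
    obtain ⟨i, rfl⟩ : ∃ i, j = i + 1 := ⟨j - 1, by omega⟩
    exact ⟨⟨i, by omega⟩, ⟨by simp only; omega, fun h => h3 ⟨_, h, rfl⟩⟩, rfl⟩

theorem coe_rowSums_innerRows (hR : R ∈ ribbons m) (hn : R.length ≤ n) :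
    (rowSums R (innerRows n R) : Set ℕ) = R.Des := by
  rw [Des_eq hR]
  simpa using coe_rowSums hn ∅

end BlockProducts

/-! ### Specialization to elementary symmetric functions -/

section JacobiTrudi

variable {σ : Type*} {m n : ℕ} {R : SkewShape}

open SkewShape

theorem elemSymm_zero (x : ℕ ↪ σ) : elemSymm x 0 = 1 := by
  classical
  ext a
  rw [MvPowerSeries.coeff_one]
  change (if _ then _ else _) = _
  by_cases ha : a = 0
  · subst ha; simp
  · rw [if_neg, if_neg ha]
    rintro ⟨h, -⟩
    exact ha ((Finsupp.degree_eq_zero_iff a).1 (by exact_mod_cast h))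

theorem elemSymm_neg (x : ℕ ↪ σ) {d : ℤ} (hd : d < 0) : elemSymm x d = 0 := by
  classical
  ext a
  change (if _ then _ else _) = _
  rw [if_neg, map_zero]
  rintro ⟨h, -⟩
  omega

/-- The products of elementary symmetric functions in several alphabets. -/
noncomputable def elemProd {k : ℕ} (x : Fin k → ℕ ↪ σ) (d : ℤ) : MvPowerSeries σ ℂ :=
  ∏ p, elemSymm (x p) d

theorem elemProd_zero {k : ℕ} (x : Fin k → ℕ ↪ σ) : elemProd x 0 = 1 := by
  simp [elemProd, elemSymm_zero]

/-- Here k ≥ 1 matters: a product over no alphabets would be 1 in negative degrees too. -/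
theorem elemProd_neg {k : ℕ} (hk : 1 ≤ k) (x : Fin k → ℕ ↪ σ) (d : ℤ) (hd : d < 0) :
    elemProd x d = 0 :=
  prod_eq_zero (mem_univ ⟨0, hk⟩) (elemSymm_neg _ hd)

theorem hadamardProd_JT {k : ℕ} (n : ℕ) (R : SkewShape) (x : Fin k → ℕ ↪ σ) :
    hadamardProd (fun p => JT n R (x p)) = shapeMatrix n R (elemProd x) := rfl

theorem JT_eq_shapeMatrix (n : ℕ) (R : SkewShape) (x : ℕ ↪ σ) :
    JT n R x = shapeMatrix n R (elemSymm x) := rfl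

theorem exists_ribbon_Des_eq (hR : R ∈ ribbons m) (hn : R.length ≤ n)
    (I : Finset (Fin (n - 1))) : ∃ RI ∈ ribbons m, RI.Des =
      d (Set.Icc 1 (R.length - 1) \ {j | ∃ i ∈ I, j = (i : ℕ) + 1}) R := by
  rw [← coe_rowSums hn I]
  refine ⟨_, ofDescents_mem_ribbons, Des_ofDescents fun x hx => ?_⟩
  obtain ⟨i, hi', rfl⟩ := mem_image.1 hx
  have h := mem_innerRows.1 (mem_sdiff.1 hi').1
  constructor
  · exact (Nat.zero_le _).trans_lt (rowSum_lt_rowSum hR (Nat.lt_succ_self (i : ℕ)) h.le)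
  · exact (rowSum_lt_rowSum hR h le_rfl).trans_eq (rowSum_length_eq hR)

/-- Both sides are alternating sums determined by E, m and a set of cuts; the hypothesis on the
descent set identifies the two sets. -/
theorem tlImmanant_tau_eq_det {A : Type*} [CommRing A] [Algebra ℂ A] {N : ℕ} {RI : SkewShape}
    (hR : R ∈ ribbons m) (hn : R.length ≤ n) {I : Finset (Fin (n - 1))}
    (hI : I ⊆ innerRows n R) (hRI : RI ∈ ribbons m) (hDes : RI.Des =
      d (Set.Icc 1 (R.length - 1) \ {j | ∃ i ∈ I, j = (i : ℕ) + 1}) R) (hN : RI.length ≤ N)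
    {E : ℤ → A} (h0 : E 0 = 1) (hneg : ∀ d < 0, E d = 0) :
    tlImmanant (tau I) (shapeMatrix n R E) = (shapeMatrix N RI E).det := by
  rw [tlImmanant_tau_shapeMatrix hR hn h0 hneg hI, det_shapeMatrix hRI hN h0 hneg]
  congr 1
  rw [← coe_inj, coe_rowSums hn, coe_rowSums_innerRows hRI hN, hDes]

end JacobiTrudi

end TLImm

theorem mainTheorem6 (m n k : ℕ) (hk : 1 ≤ k) (R : TLImm.SkewShape)
    (hR : R ∈ TLImm.SkewShape.ribbons m) (hn : R.length ≤ n) :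
    (∀ I : Finset (Fin (n - 1)), (∀ i ∈ I, (i : ℕ) + 1 < R.length) →
      (∃ RI ∈ TLImm.SkewShape.ribbons m, RI.Des =
        TLImm.SkewShape.d (Set.Icc 1 (R.length - 1) \ {j | ∃ i ∈ I, j = (i : ℕ) + 1}) R) ∧
      ∀ RI ∈ TLImm.SkewShape.ribbons m, RI.Des =
          TLImm.SkewShape.d (Set.Icc 1 (R.length - 1) \ {j | ∃ i ∈ I, j = (i : ℕ) + 1}) R →
        (∀ N : ℕ, RI.length ≤ N →
          TLImm.tlImmanant (TLImm.tau I)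
              (TLImm.hadamardProd fun p : Fin k => TLImm.JT n R (TLImm.alphabet p)) =
            (TLImm.hadamardProd fun p : Fin k => TLImm.JT N RI (TLImm.alphabet p)).det) ∧
        TLImm.tlImmanant (TLImm.tau I) (TLImm.JT n R (Function.Embedding.refl ℕ)) =
          TLImm.skewSchur RI.conjugate (Function.Embedding.refl ℕ)) ∧
    (∀ τ : TLImm.KauffmanDiagram n,
      (∀ I : Finset (Fin (n - 1)), (∀ i ∈ I, (i : ℕ) + 1 < R.length) → τ ≠ TLImm.tau I) →
      TLImm.tlImmanant τ (TLImm.JT n R (Function.Embedding.refl ℕ)) = 0) := by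
  refine ⟨fun I hI => ⟨TLImm.exists_ribbon_Des_eq hR hn I, fun RI hRI hDes => ?_⟩, fun τ hτ => ?_⟩
  · have hI' : I ⊆ TLImm.innerRows n R := fun i hi => TLImm.mem_innerRows.2 (hI i hi)
    refine ⟨fun N hN => ?_, ?_⟩
    · rw [TLImm.hadamardProd_JT, TLImm.hadamardProd_JT]
      exact TLImm.tlImmanant_tau_eq_det hR hn hI' hRI hDes hN (TLImm.elemProd_zero _)
        (TLImm.elemProd_neg hk _)
    -- The definition of `skewSchur` conjugates once more, so the Schur function is the determinant
    -- for `RI` itself, of size `RI.length`.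
    · have hconj : RI.conjugate.conjugate = RI := by
        ext1 <;> exact YoungDiagram.transpose_transpose _
      rw [TLImm.skewSchur, hconj, TLImm.JT_eq_shapeMatrix, TLImm.JT_eq_shapeMatrix]
      exact TLImm.tlImmanant_tau_eq_det hR hn hI' hRI hDes le_rfl (TLImm.elemSymm_zero _)
        (fun _ => TLImm.elemSymm_neg _)
  · rw [TLImm.JT_eq_shapeMatrix]
    exact TLImm.tlImmanant_shapeMatrix_eq_zero hR hn (TLImm.elemSymm_zero _)
      (fun _ => TLImm.elemSymm_neg _) fun I hI => hτ I fun i hi => TLImm.mem_innerRows.1 (hI hi)
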